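/- Let $k$ be an algebraically closed field of characteristic $p>3$, let $A=k[X]/(X^p)$, let $x$ be the class of $X$, and let $W=\mathrm{Der}_k(A)$ be the Witt algebra, with basis $e_i=x^{i+1}\partial$ ($-1\le i\le p-2$), where $\partial=d/dx$. Let $W^*$ be the dual space with dual basis $e_{-1}',\dots,e_{p-2}'$, and let $G=\mathrm{Aut}(W)$ be the group of Lie algebra automorphisms of $W$, acting on $W^*$ by $(g\cdot\chi)(w)=\chi(g^{-1}(w))$. Put $W_{\ge i}=\bigoplus_{j\ge i}ke_j$. The height $r(\chi)$ of $\chi\in W^*$ is $p-1$ if $\chi(e_{p-2})\ne0$, and otherwise it is $\min\{i\in\{-1,\dots,p-2\}\mid \chi|_{W_{\ge i}}=0\}$. For $j\in\mathbb N$ let $k^{(j)}\subseteq k$ be any set of representatives for the classes of the equivalence relation $x\sim y\Leftrightarrow x^j=y^j$ on $k$. Then the height is constant on $G$-orbits, and a set of representatives for the $G$-orbits of height $i$ in $W^*$ (i.e. a set of characters of height $i$ that meets each orbit of height $i$ in exactly one point) is: 1. $\{ae_0'\mid a\in k^*\}$ if $i=1$; 2. $\{e_{i-1}'\}$ if $0\le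 i\le p-3$ and $i$ is even; 3. $\{e_{i-1}'+ae_{\frac{i-1}{2}}'\mid a\in k^{(2)}\}$ if $3\le i\le p-2$ and $i$ is odd; 4. $\{e_{p-2}'+ae_{-1}'\mid a\in k^{(p-2)}\}$ if $i=p-1$. Furthermore, the dimensions of the orbits (as subspaces of $W^*$ in the Zariski topology) are: 1. $\dim G(ae_0')=1$ for $a\in k^*$; 2. $\dim Ge_{i-1}'=i+1$ if $0\le i\le p-3$ and $i$ is even; 3. $\dim G(e_{i-1}'+ae_{\frac{i-1}{2}}')=i$ for all $a\in k$, if $3\le i\le p-2$ and $i$ is odd; 4. $\dim G(e_{p-2}'+ae_{-1}')=p-1$ for all $a\in k$. -/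

import Mathlib

open Polynomial

noncomputable section

namespace WittAlgebra

variable (k : Type*) [Field k] (p : ℕ)

/-- The truncated polynomial ring `A(1) = k[X] / (X ^ p)`. -/
abbrev TruncPoly : Type _ := AdjoinRoot (X ^ p : k[X])

/-- The class `x` of the variable `X` in `A(1)`. -/
abbrev x : TruncPoly k p := AdjoinRoot.root (X ^ p : k[X])

/-- The Witt algebra: the Lie algebra of `k`-linear derivations of `A(1)`,
with the commutator bracket. -/
abbrev W : Type _ := Derivation k (TruncPoly k p) (TruncPoly k p)

theorem mk_derivative_eq_zero [CharP k p] (f : k[X])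
    (hf : AdjoinRoot.mkₐ (X ^ p : k[X]) f = 0) :
    AdjoinRoot.mkₐ (X ^ p : k[X]) (Polynomial.derivative' f) = 0 := by
  have h : (X ^ p : k[X]) ∣ f := AdjoinRoot.mk_eq_zero.mp hf
  obtain ⟨g, rfl⟩ := h
  refine AdjoinRoot.mk_eq_zero.mpr ⟨derivative g, ?_⟩
  change derivative (X ^ p * g) = _
  simp [derivative_mul, derivative_X_pow]

/-- The derivation `∂ = d/dx` of `A(1)`, induced by the formal derivative of polynomials
(well defined since `k` has characteristic `p`). -/
def del [CharP k p] : W k p :=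
  Derivation.liftOfSurjective (f := AdjoinRoot.mkₐ (X ^ p : k[X])) (AdjoinRoot.mk_surjective)
    (d := Polynomial.derivative') (mk_derivative_eq_zero k p)

theorem del_mk [CharP k p] (f : k[X]) :
    del k p (AdjoinRoot.mk (X ^ p) f) = AdjoinRoot.mk (X ^ p) (derivative f) :=
  Derivation.liftOfSurjective_apply (f := AdjoinRoot.mkₐ (X ^ p : k[X])) AdjoinRoot.mk_surjective
    (mk_derivative_eq_zero k p) f

theorem del_x [CharP k p] : del k p (x k p) = 1 := by
  have := del_mk k p X
  simpa using this

/-- Two derivations of `A(1)` that agree at `x` are equal. -/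
theorem W_ext {D E : W k p} (h : D (x k p) = E (x k p)) : D = E := by
  ext a
  obtain ⟨f, rfl⟩ := AdjoinRoot.mk_surjective a
  have hf : AdjoinRoot.mk (X ^ p) f = Polynomial.aeval (x k p) f := by
    simp [AdjoinRoot.aeval_eq]
  rw [hf, Derivation.map_aeval, Derivation.map_aeval, h]

/-- `D ↦ D(x)` is a linear isomorphism from `W` to `A(1)`, with inverse `a ↦ a ∂`. -/
def evalX [CharP k p] : W k p ≃ₗ[k] TruncPoly k p where
  toFun D := D (x k p)
  map_add' _ _ := rfl
  map_smul' _ _ := rfl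
  invFun a := a • del k p
  left_inv D := W_ext k p (by simp [del_x])
  right_inv a := by simp [del_x]

/-- The basis `1, x, …, x ^ (p - 1)` of `A(1)`. -/
def truncBasis : Module.Basis (Fin p) k (TruncPoly k p) :=
  (AdjoinRoot.powerBasis' (monic_X_pow (R := k) p)).basis.reindex (finCongr (by simp))

theorem truncBasis_apply (n : Fin p) : truncBasis k p n = x k p ^ (n : ℕ) := by
  simp [truncBasis]

/-- The basis of `W` whose `n`-th member, for `0 ≤ n < p`, is `x ^ n ∂`. -/
def basis [CharP k p] : Module.Basis (Fin p) k (W k p) :=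
  (truncBasis k p).map (evalX k p).symm

theorem basis_apply [CharP k p] (n : Fin p) : basis k p n = x k p ^ (n : ℕ) • del k p := by
  simp [basis, truncBasis_apply, evalX]

/-- The element `e_i = x ^ (i + 1) ∂` of `W`, for an integer `i` with `-1 ≤ i ≤ p - 2`.
(For other `i` the value is `0` and is not used.) -/
def e [CharP k p] (i : ℤ) : W k p :=
  if -1 ≤ i ∧ i ≤ (p : ℤ) - 2 then x k p ^ (i + 1).toNat • del k p else 0

/-- The functional `e_i'`, for `-1 ≤ i ≤ p - 2`: the member dual to `e_i` of the basis
of `W*` dual to `e_{-1}, …, e_{p-2}`. (For other `i` the value is `0` and is not used.) -/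
def e' [CharP k p] (i : ℤ) : Module.Dual k (W k p) :=
  if h : -1 ≤ i ∧ i ≤ (p : ℤ) - 2 then (basis k p).coord ⟨(i + 1).toNat, by omega⟩ else 0

/-- The defining property of the dual basis. -/
theorem e'_e [CharP k p] {i j : ℤ} (hi : -1 ≤ i ∧ i ≤ (p : ℤ) - 2)
    (hj : -1 ≤ j ∧ j ≤ (p : ℤ) - 2) : e' k p i (e k p j) = if i = j then 1 else 0 := by
  have hej : e k p j = basis k p ⟨(j + 1).toNat, by omega⟩ := by
    rw [basis_apply, e, if_pos hj]
  rw [hej, e', dif_pos hi, Module.Basis.coord_apply, Module.Basis.repr_self, Finsupp.single_apply]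
  refine if_congr ?_ rfl rfl
  rw [Fin.mk.injEq]
  omega

/-- `W_{≥ i}`, the span of the `e_j` with `i ≤ j ≤ p - 2`. -/
def Wge [CharP k p] (i : ℤ) : Submodule k (W k p) :=
  Submodule.span k {w | ∃ j : ℤ, -1 ≤ j ∧ i ≤ j ∧ j ≤ (p : ℤ) - 2 ∧ w = e k p j}

variable {k p}

open Classical in
/-- The height of a character `χ ∈ W*`: the least `i ∈ {-1, …, p - 2}` such that `χ` vanishes on
`W_{≥ i}` if `χ(e_{p-2}) = 0`, and `p - 1` otherwise. -/
def height [CharP k p] (χ : Module.Dual k (W k p)) : ℤ :=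
  if χ (e k p ((p : ℤ) - 2)) = 0 then
    sInf {i : ℤ | -1 ≤ i ∧ i ≤ (p : ℤ) - 2 ∧ ∀ w ∈ Wge k p i, χ w = 0}
  else (p : ℤ) - 1

/-- The action of the automorphism group `G = Aut(W)` on `W*`: `(g · χ)(w) = χ(g⁻¹ w)`. -/
def act (g : W k p ≃ₗ⁅k⁆ W k p) (χ : Module.Dual k (W k p)) : Module.Dual k (W k p) :=
  χ ∘ₗ (g.symm.toLinearEquiv : W k p →ₗ[k] W k p)

theorem act_apply (g : W k p ≃ₗ⁅k⁆ W k p) (χ : Module.Dual k (W k p)) (w : W k p) :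
    act g χ w = χ (g.symm w) := rfl

/-- The orbit of `χ` under `G = Aut(W)`. -/
def orbit (χ : Module.Dual k (W k p)) : Set (Module.Dual k (W k p)) :=
  {ψ | ∃ g : W k p ≃ₗ⁅k⁆ W k p, ψ = act g χ}

/-- `R` is a set of representatives for the orbits of height `i`: every member of `R` has
height `i`, and the orbit of each character of height `i` contains exactly one member of `R`. -/
def IsOrbitRepresentatives [CharP k p] (i : ℤ) (R : Set (Module.Dual k (W k p))) : Prop :=
  (∀ ρ ∈ R, height ρ = i) ∧ ∀ χ, height χ = i → ∃! ρ, ρ ∈ R ∧ ρ ∈ orbit χ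

variable (k) in
/-- `S` is a set of representatives for the classes of the equivalence relation
`a ∼ b ↔ a ^ j = b ^ j` on `k`. -/
def IsPowRepresentatives (j : ℕ) (S : Set k) : Prop :=
  ∀ a : k, ∃! b, b ∈ S ∧ a ^ j = b ^ j

variable (k) in
/-- The set of common zeros in the affine space `k ^ ι` of a set of polynomials. -/
def zeros {ι : Type*} (S : Set (MvPolynomial ι k)) : Set (ι → k) :=
  {v | ∀ f ∈ S, MvPolynomial.eval v f = 0}

variable (k) in
/-- The Zariski topology on the affine space `k ^ ι`: the closed sets are the sets of common
zeros of polynomials. -/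
@[reducible]
def zariski (ι : Type*) : TopologicalSpace (ι → k) :=
  TopologicalSpace.ofClosed {Z | ∃ S : Set (MvPolynomial ι k), Z = zeros k S}
    ⟨{1}, by ext v; simp [zeros]⟩
    (fun A hA => by
      refine ⟨{f | ∃ S : Set (MvPolynomial ι k), zeros k S ∈ A ∧ f ∈ S}, ?_⟩
      ext v
      simp only [Set.mem_sInter, zeros, Set.mem_ofPred_eq]
      constructor
      · rintro h f ⟨S, hS, hf⟩
        exact h _ hS f hf
      · intro h Z hZ
        obtain ⟨S, rfl⟩ := hA hZ
        exact fun f hf => h f ⟨S, hZ, hf⟩)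
    (by
      rintro _ ⟨S, rfl⟩ _ ⟨T, rfl⟩
      refine ⟨{h | ∃ f ∈ S, ∃ g ∈ T, h = f * g}, ?_⟩
      ext v
      simp only [Set.mem_union, zeros, Set.mem_ofPred_eq]
      constructor
      · rintro (h | h) _ ⟨f, hf, g, hg, rfl⟩
        · simp [h f hf]
        · simp [h g hg]
      · intro h
        by_contra! hc
        obtain ⟨⟨f, hf, hfv⟩, g, hg, hgv⟩ := hc
        have := h _ ⟨f, hf, g, hg, rfl⟩
        rw [map_mul, mul_eq_zero] at this
        exact this.elim hfv hgv)

/-- The coordinates of `χ ∈ W*` with respect to `e_{-1}', …, e_{p-2}'`. -/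
def coords [CharP k p] (χ : Module.Dual k (W k p)) : Fin p → k :=
  fun n => χ (basis k p n)

/-- The dimension of a subset `O` of the affine space `W*`: the Krull dimension of the topological
space `O` with the topology induced by the Zariski topology of `W*`. -/
def dim [CharP k p] (O : Set (Module.Dual k (W k p))) : WithBot ℕ∞ :=
  @topologicalKrullDim O
    (TopologicalSpace.induced (fun χ : O => coords (χ : Module.Dual k (W k p)))
      (zariski k (Fin p)))

end WittAlgebra

end

/-!
Every functional on `W` is `f ∂ ↦ Res (x⁻ᵖ q f dx)` for a unique `q ∈ A`. Automorphisms of `W` come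
from substitutions `x ↦ y`, because they preserve `W_{≥ 0}`, which is determined by the elements `c`
with `(ad c)² = 0`. Under a substitution `q` transforms, up to a constant, like the quadratic
differential `q dx²`.

If the functional has height `i ≥ 0`, then `q = α xⁿ r²` with `n = p - 1 - i`, `α ≠ 0` and
`r(0) = 1`. Choose `m` with `2 m ≡ n` modulo `p`, so that `xᵐ r dx` is, up to constants, a square
root of `q dx²`. Its residue is one coefficient of `r`, that of `xˢ` with `s ≡ -1 - m`, and changes
only by scaling. All other coefficients can be removed by substitutions `x ↦ x + t xʲ⁺¹`. For even
`i ≤ p - 3` one has `x ^ (n + s) = 0`, and no parameter is left; for `i = 1` the parameter is `α`,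
since `s = 0`; in the other cases `x ↦ c x` normalizes `α` to `1`. In the coordinates `α` and
`α r_j` with `j ≤ i`, which are regular in both directions, an orbit becomes a principal open set or
the graph of a regular function on one.
-/

noncomputable section

namespace WittAlgebra

section Coefficients

variable {k : Type*} [Field k] {p : ℕ}

/-- The coefficient of `x ^ n` in an element of `k[X] / (X ^ p)`; it is `0` for `p ≤ n`. -/
def truncCoeff (n : ℕ) : TruncPoly k p →ₗ[k] k :=
  lcoeff k n ∘ₗ AdjoinRoot.modByMonicHom (monic_X_pow (R := k) p)

theorem truncCoeff_mk {n : ℕ} (hn : n < p) (f : k[X]) :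
    truncCoeff n (AdjoinRoot.mk (X ^ p : k[X]) f) = f.coeff n := by
  change (f %ₘ X ^ p).coeff n = f.coeff n
  conv_rhs => rw [← modByMonic_add_div f (X ^ p : k[X])]
  rw [coeff_add, coeff_X_pow_mul', if_neg (by lia), add_zero]

theorem truncCoeff_of_le {n : ℕ} (hn : p ≤ n) (a : TruncPoly k p) : truncCoeff n a = 0 := by
  obtain ⟨f, rfl⟩ := AdjoinRoot.mk_surjective a
  refine coeff_eq_zero_of_degree_lt ((degree_modByMonic_lt f (monic_X_pow p)).trans_le ?_)
  rw [degree_X_pow]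
  exact_mod_cast hn

theorem ext_truncCoeff {a b : TruncPoly k p} (h : ∀ n < p, truncCoeff n a = truncCoeff n b) :
    a = b := by
  obtain ⟨f, rfl⟩ := AdjoinRoot.mk_surjective a
  obtain ⟨g, rfl⟩ := AdjoinRoot.mk_surjective b
  rw [AdjoinRoot.mk_eq_mk, X_pow_dvd_iff]
  intro n hn
  rw [coeff_sub, ← truncCoeff_mk hn, ← truncCoeff_mk hn, h n hn, sub_self]

theorem x_pow_eq_mk (m : ℕ) : x k p ^ m = AdjoinRoot.mk (X ^ p : k[X]) (X ^ m) := by simp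

theorem truncCoeff_x_pow {n : ℕ} (hn : n < p) (m : ℕ) :
    truncCoeff n (x k p ^ m) = if n = m then 1 else 0 := by
  rw [x_pow_eq_mk, truncCoeff_mk hn, coeff_X_pow]

theorem truncCoeff_x_pow_mul_of_lt {m n : ℕ} (h : n < m) (hn : n < p) (a : TruncPoly k p) :
    truncCoeff n (x k p ^ m * a) = 0 := by
  obtain ⟨f, rfl⟩ := AdjoinRoot.mk_surjective a
  rw [x_pow_eq_mk, ← map_mul, truncCoeff_mk hn, coeff_X_pow_mul',
    if_neg (by lia)]

theorem truncCoeff_add_x_pow_mul {m n : ℕ} (h : m + n < p) (a : TruncPoly k p) :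
    truncCoeff (m + n) (x k p ^ m * a) = truncCoeff n a := by
  obtain ⟨f, rfl⟩ := AdjoinRoot.mk_surjective a
  rw [x_pow_eq_mk, ← map_mul, truncCoeff_mk h, truncCoeff_mk (by lia),
    coeff_X_pow_mul', if_pos (by lia), Nat.add_sub_cancel_left]

theorem truncCoeff_x_pow_mul_self {m : ℕ} (h : m < p) (a : TruncPoly k p) :
    truncCoeff m (x k p ^ m * a) = truncCoeff 0 a :=
  truncCoeff_add_x_pow_mul (n := 0) h a

theorem x_pow_eq_zero {n : ℕ} (hn : p ≤ n) : x k p ^ n = 0 := by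
  refine pow_eq_zero_of_le hn ?_
  rw [x_pow_eq_mk, AdjoinRoot.mk_self]

theorem x_pow_dvd_iff {m : ℕ} (hm : m ≤ p) {a : TruncPoly k p} :
    x k p ^ m ∣ a ↔ ∀ n < m, truncCoeff n a = 0 := by
  constructor
  · rintro ⟨b, rfl⟩ n hn
    exact truncCoeff_x_pow_mul_of_lt hn (by lia) b
  · intro h
    obtain ⟨f, rfl⟩ := AdjoinRoot.mk_surjective a
    have : X ^ m ∣ f :=
      X_pow_dvd_iff.mpr fun n hn => by rw [← truncCoeff_mk (p := p) (by lia), h n hn]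
    simpa using map_dvd (AdjoinRoot.mk (X ^ p : k[X])) this

theorem eq_sum_truncCoeff_smul (a : TruncPoly k p) :
    a = ∑ j ∈ Finset.range p, truncCoeff j a • x k p ^ j :=
  ext_truncCoeff fun n hn => by simp [truncCoeff_x_pow hn, hn]

theorem mul_eq_zero_of_x_pow_dvd {m n : ℕ} (h : p ≤ m + n) {a b : TruncPoly k p}
    (ha : x k p ^ m ∣ a) (hb : x k p ^ n ∣ b) : a * b = 0 :=
  zero_dvd_iff.mp (x_pow_eq_zero (k := k) h ▸ pow_add (x k p) m n ▸ mul_dvd_mul ha hb)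

theorem pow_eq_zero_of_x_dvd {a : TruncPoly k p} (ha : x k p ∣ a) : a ^ p = 0 :=
  zero_dvd_iff.mp (x_pow_eq_zero (k := k) le_rfl ▸ pow_dvd_pow_of_dvd ha p)

section Constant

variable [NeZero p]

theorem x_dvd_iff {a : TruncPoly k p} : x k p ∣ a ↔ truncCoeff 0 a = 0 := by
  simpa using x_pow_dvd_iff (k := k) (m := 1) (NeZero.one_le (n := p)) (a := a)

theorem truncCoeff_zero_mul (a b : TruncPoly k p) :
    truncCoeff 0 (a * b) = truncCoeff 0 a * truncCoeff 0 b := by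
  obtain ⟨f, rfl⟩ := AdjoinRoot.mk_surjective a
  obtain ⟨g, rfl⟩ := AdjoinRoot.mk_surjective b
  simp only [← map_mul, truncCoeff_mk (NeZero.pos p), mul_coeff_zero]

theorem truncCoeff_zero_one : truncCoeff 0 (1 : TruncPoly k p) = 1 := by
  simpa using truncCoeff_x_pow (k := k) (NeZero.pos p) 0

theorem truncCoeff_zero_pow (a : TruncPoly k p) (n : ℕ) :
    truncCoeff 0 (a ^ n) = truncCoeff 0 a ^ n := by
  induction n with
  | zero => simp [truncCoeff_zero_one]
  | succ n ih => rw [pow_succ, truncCoeff_zero_mul, ih, pow_succ]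

theorem exists_eq_smul_one_add_x_mul (a : TruncPoly k p) :
    ∃ b, a = truncCoeff 0 a • 1 + x k p * b := by
  have : x k p ∣ a - truncCoeff 0 a • 1 := by simp [x_dvd_iff, truncCoeff_zero_one]
  exact this.imp fun b hb => by rw [← hb, add_sub_cancel]

theorem isUnit_of_truncCoeff_zero_ne {a : TruncPoly k p} (ha : truncCoeff 0 a ≠ 0) :
    IsUnit a := by
  obtain ⟨b, hb⟩ := exists_eq_smul_one_add_x_mul a
  rw [hb, ← Algebra.algebraMap_eq_smul_one]
  exact IsNilpotent.isUnit_add_left_of_commute ⟨p, pow_eq_zero_of_x_dvd (dvd_mul_right _ _)⟩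
    ((IsUnit.mk0 _ ha).map _) (Commute.all _ _)

instance : Nontrivial (TruncPoly k p) :=
  ⟨0, 1, fun h => by simpa [truncCoeff_zero_one] using congrArg (truncCoeff 0) h⟩

theorem pow_char_eq [Fact p.Prime] [CharP k p] (a : TruncPoly k p) :
    a ^ p = truncCoeff 0 a ^ p • 1 := by
  have := charP_of_injective_algebraMap (algebraMap k (TruncPoly k p)).injective p
  obtain ⟨b, hb⟩ := exists_eq_smul_one_add_x_mul a
  conv_lhs => rw [hb]
  rw [add_pow_char, pow_eq_zero_of_x_dvd (dvd_mul_right _ b), add_zero, _root_.smul_pow, one_pow]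

end Constant

/-- `a` vanishes to order exactly `n` at `x = 0`. Since `truncCoeff n` is zero for `p ≤ n`, this
includes `n < p`. -/
def HasOrder (n : ℕ) (a : TruncPoly k p) : Prop :=
  x k p ^ n ∣ a ∧ truncCoeff n a ≠ 0

theorem HasOrder.lt {n : ℕ} {a : TruncPoly k p} (h : HasOrder n a) : n < p :=
  not_le.mp fun hn => h.2 (truncCoeff_of_le hn a)

theorem exists_hasOrder {a : TruncPoly k p} (ha : a ≠ 0) : ∃ n, HasOrder n a := by
  classical
  have h : ∃ n, truncCoeff n a ≠ 0 := by
    by_contra! h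
    exact ha (ext_truncCoeff fun n _ => by rw [h n, map_zero])
  have hlt : Nat.find h < p := not_le.mp fun hp => Nat.find_spec h (truncCoeff_of_le hp a)
  exact ⟨_, (x_pow_dvd_iff hlt.le).mpr fun m hm => not_not.mp (Nat.find_min h hm),
    Nat.find_spec h⟩

theorem exists_eq_x_pow_mul {n : ℕ} (hn : n < p) {a : TruncPoly k p} (h : x k p ^ n ∣ a) :
    ∃ u, a = x k p ^ n * u ∧ truncCoeff 0 u = truncCoeff n a :=
  h.imp fun u hu => ⟨hu, by rw [hu, truncCoeff_x_pow_mul_self hn]⟩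

theorem truncCoeff_add_mul {m n : ℕ} (h : m + n < p) {a b : TruncPoly k p}
    (ha : x k p ^ m ∣ a) (hb : x k p ^ n ∣ b) :
    truncCoeff (m + n) (a * b) = truncCoeff m a * truncCoeff n b := by
  have : NeZero p := ⟨by lia⟩
  obtain ⟨u, rfl, hu⟩ := exists_eq_x_pow_mul (by lia) ha
  obtain ⟨v, rfl, hv⟩ := exists_eq_x_pow_mul (by lia) hb
  rw [← hu, ← hv, mul_mul_mul_comm, ← pow_add, truncCoeff_x_pow_mul_self h, truncCoeff_zero_mul]

theorem HasOrder.le_add_of_mul_eq_zero {m n : ℕ} {a b : TruncPoly k p} (ha : HasOrder m a)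
    (hb : HasOrder n b) (h : a * b = 0) : p ≤ m + n := by
  by_contra! hlt
  have := truncCoeff_add_mul hlt ha.1 hb.1
  rw [h, map_zero] at this
  exact mul_ne_zero ha.2 hb.2 this.symm

end Coefficients

section Derivations

variable {k : Type*} [Field k] {p : ℕ} [CharP k p]

theorem natCast_ne_zero_of_lt {n : ℕ} (h0 : n ≠ 0) (hn : n < p) : (n : k) ≠ 0 := by
  rw [Ne, CharP.cast_eq_zero_iff k p]
  exact Nat.not_dvd_of_pos_of_lt (Nat.pos_of_ne_zero h0) hn

theorem truncCoeff_del {n : ℕ} (hn : n < p) (a : TruncPoly k p) :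
    truncCoeff n (del k p a) = (n + 1) * truncCoeff (n + 1) a := by
  obtain ⟨f, rfl⟩ := AdjoinRoot.mk_surjective a
  rw [del_mk, truncCoeff_mk hn, coeff_derivative]
  rcases Nat.lt_or_ge (n + 1) p with h | h
  · rw [truncCoeff_mk h, mul_comm]
  · obtain rfl : p = n + 1 := by lia
    rw [← Nat.cast_add_one, CharP.cast_eq_zero k (n + 1), mul_zero, zero_mul]

theorem truncCoeff_zero_del [NeZero p] (a : TruncPoly k p) :
    truncCoeff 0 (del k p a) = truncCoeff 1 a := by
  simpa using truncCoeff_del (NeZero.pos p) a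

theorem truncCoeff_pred_del (a : TruncPoly k p) : truncCoeff (p - 1) (del k p a) = 0 := by
  rcases p.eq_zero_or_pos with rfl | hp
  · exact truncCoeff_of_le (by lia) _
  · rw [truncCoeff_del (by lia), truncCoeff_of_le (by lia), mul_zero]

theorem del_pow (a : TruncPoly k p) (n : ℕ) :
    del k p (a ^ n) = (n : k) • (a ^ (n - 1) * del k p a) := by
  rw [Derivation.leibniz_pow, smul_eq_mul, Nat.cast_smul_eq_nsmul]

theorem del_x_pow (n : ℕ) : del k p (x k p ^ n) = (n : k) • x k p ^ (n - 1) := by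
  rw [del_pow, del_x, mul_one]

theorem x_pow_pred_dvd_del {n : ℕ} {a : TruncPoly k p} (h : x k p ^ n ∣ a) :
    x k p ^ (n - 1) ∣ del k p a := by
  obtain ⟨b, rfl⟩ := h
  rw [Derivation.leibniz, del_x_pow, smul_eq_mul, smul_eq_mul]
  exact dvd_add (Dvd.dvd.mul_right (pow_dvd_pow _ (Nat.sub_le n 1)) _)
    (Dvd.dvd.mul_left (dvd_smul_of_dvd _ dvd_rfl) _)

theorem HasOrder.del {n : ℕ} {a : TruncPoly k p} (h : HasOrder n a) (hn : n ≠ 0) :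
    HasOrder (n - 1) (del k p a) := by
  refine ⟨x_pow_pred_dvd_del h.1, ?_⟩
  rw [truncCoeff_del (by have := h.lt; lia), Nat.sub_add_cancel (by lia), ← Nat.cast_add_one,
    Nat.sub_add_cancel (by lia)]
  exact mul_ne_zero (natCast_ne_zero_of_lt hn h.lt) h.2

theorem smul_del_apply_x (a : TruncPoly k p) : (a • del k p) (x k p) = a := by
  simp [del_x]

theorem derivation_apply (D : W k p) (a : TruncPoly k p) : D a = D (x k p) * del k p a :=
  DFunLike.congr_fun (W_ext k p (smul_del_apply_x (D (x k p))).symm : D = D (x k p) • del k p) a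

theorem lie_apply_x (D E : W k p) :
    ⁅D, E⁆ (x k p) = D (x k p) * del k p (E (x k p)) - E (x k p) * del k p (D (x k p)) := by
  rw [Derivation.commutator_apply, derivation_apply D (E _), derivation_apply E (D _)]

end Derivations

section Substitution

variable {k : Type*} [Field k] {p : ℕ} {y : TruncPoly k p}

/-- The substitution `x ↦ y`: the algebra endomorphism of `k[X] / (X ^ p)` that maps `x` to a
multiple `y` of `x`. -/
def substHom (hy : x k p ∣ y) : TruncPoly k p →ₐ[k] TruncPoly k p :=
  AdjoinRoot.liftAlgHom _ (Algebra.ofId k _) y (by simp [pow_eq_zero_of_x_dvd hy])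

theorem substHom_mk (hy : x k p ∣ y) (f : k[X]) :
    substHom hy (AdjoinRoot.mk _ f) = aeval y f := by
  rw [substHom, AdjoinRoot.liftAlgHom_mk]
  rfl

theorem substHom_x (hy : x k p ∣ y) : substHom hy (x k p) = y := by
  simp [substHom]

theorem sub_dvd_substHom_sub (hy : x k p ∣ y) (a : TruncPoly k p) :
    y - x k p ∣ substHom hy a - a := by
  obtain ⟨f, rfl⟩ := AdjoinRoot.mk_surjective a
  have := Polynomial.sub_dvd_eval_sub y (x k p) (f.map (algebraMap k (TruncPoly k p)))
  rwa [eval_map_algebraMap, eval_map_algebraMap, AdjoinRoot.aeval_eq, ← substHom_mk hy] at this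

theorem x_pow_dvd_substHom (hy : x k p ∣ y) {n : ℕ} {a : TruncPoly k p} (h : x k p ^ n ∣ a) :
    x k p ^ n ∣ substHom hy a := by
  have := map_dvd (substHom hy) h
  rw [map_pow, substHom_x] at this
  exact (pow_dvd_pow_of_dvd hy n).trans this

theorem truncCoeff_pow (hy : x k p ∣ y) {n : ℕ} (hn : n < p) :
    truncCoeff n (y ^ n) = truncCoeff 1 y ^ n := by
  induction n with
  | zero =>
    have : NeZero p := ⟨by lia⟩
    rw [pow_zero, pow_zero, truncCoeff_zero_one]
  | succ n ih =>
    rw [pow_succ, truncCoeff_add_mul hn (pow_dvd_pow_of_dvd hy n) (by rwa [pow_one]), ih (by lia),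
      pow_succ]

theorem truncCoeff_zero_substHom [NeZero p] (hy : x k p ∣ y) (a : TruncPoly k p) :
    truncCoeff 0 (substHom hy a) = truncCoeff 0 a := by
  have h : x k p ∣ substHom hy a - a :=
    (dvd_sub hy dvd_rfl).trans (sub_dvd_substHom_sub hy a)
  rwa [x_dvd_iff, map_sub, sub_eq_zero] at h

theorem truncCoeff_substHom (hy : x k p ∣ y) {n : ℕ} (hn : n < p) {a : TruncPoly k p}
    (h : x k p ^ n ∣ a) : truncCoeff n (substHom hy a) = truncCoeff 1 y ^ n * truncCoeff n a := by
  have : NeZero p := ⟨by lia⟩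
  obtain ⟨u, rfl, hu⟩ := exists_eq_x_pow_mul hn h
  rw [map_mul, map_pow, substHom_x, ← hu, ← truncCoeff_zero_substHom hy u, ← truncCoeff_pow hy hn]
  exact truncCoeff_add_mul (n := 0) hn (pow_dvd_pow_of_dvd hy n) (by simp)

theorem substHom_bijective (hy : x k p ∣ y) (h1 : truncCoeff 1 y ≠ 0) :
    Function.Bijective (substHom hy) := by
  have hinj : Function.Injective (substHom hy) := by
    rw [injective_iff_map_eq_zero]
    intro a ha
    by_contra hne
    obtain ⟨n, hn⟩ := exists_hasOrder hne
    have := truncCoeff_substHom hy hn.lt hn.1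
    rw [ha, map_zero] at this
    exact mul_ne_zero (pow_ne_zero n h1) hn.2 this.symm
  have : FiniteDimensional k (TruncPoly k p) := (truncBasis k p).finiteDimensional_of_finite
  exact ⟨hinj, (LinearMap.injective_iff_surjective (f := (substHom hy).toLinearMap)).mp hinj⟩

variable [CharP k p]

theorem truncCoeff_pred_pow_mul_del {n : ℕ} (hn : n + 1 < p) (y : TruncPoly k p) :
    truncCoeff (p - 1) (y ^ n * del k p y) = 0 := by
  have h0 : ((n + 1 : ℕ) : k) ≠ 0 := natCast_ne_zero_of_lt n.succ_ne_zero hn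
  have : y ^ n * del k p y = ((n + 1 : ℕ) : k)⁻¹ • del k p (y ^ (n + 1)) := by
    rw [del_pow, inv_smul_smul₀ h0, Nat.add_sub_cancel]
  rw [this, map_smul, truncCoeff_pred_del, smul_zero]

variable [NeZero p]

theorem truncCoeff_pred_pow_pred_mul_del (hy : x k p ∣ y) :
    truncCoeff (p - 1) (y ^ (p - 1) * del k p y) = truncCoeff 1 y ^ p := by
  have hp := NeZero.pos p
  have := truncCoeff_add_mul (m := p - 1) (n := 0) (b := del k p y) (by lia)
    (pow_dvd_pow_of_dvd hy _) (by simp)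
  rwa [truncCoeff_zero_del, truncCoeff_pow hy (by lia), ← pow_succ, Nat.sub_add_cancel hp] at this

-- The change of variables formula for the residue at `0` of the differential `x ^ (-p) a dx`.
theorem truncCoeff_pred_substHom_mul_del (hy : x k p ∣ y) (a : TruncPoly k p) :
    truncCoeff (p - 1) (substHom hy a * del k p y) = truncCoeff 1 y ^ p * truncCoeff (p - 1) a := by
  have hp := NeZero.pos p
  conv_lhs => rw [eq_sum_truncCoeff_smul a]
  simp only [map_sum, Finset.sum_mul, map_smul, smul_mul_assoc, map_pow, substHom_x, smul_eq_mul]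
  rw [Finset.sum_eq_single_of_mem (p - 1) (Finset.mem_range.mpr (by lia)),
    truncCoeff_pred_pow_pred_mul_del hy, mul_comm]
  intro n hn hne
  rw [truncCoeff_pred_pow_mul_del (by have := Finset.mem_range.mp hn; lia), mul_zero]

end Substitution

section Conjugation

variable {R A : Type*} [CommRing R] [CommRing A] [Algebra R A]

/-- The derivation `σ ∘ D ∘ σ⁻¹`, for a derivation `D` and an automorphism `σ` of an algebra. -/
def conjDerivation (σ : A ≃ₐ[R] A) (D : Derivation R A A) : Derivation R A A :=
  Derivation.mk' (σ.toLinearMap ∘ₗ (D : A →ₗ[R] A) ∘ₗ σ.symm.toLinearMap) fun a b => by simp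

theorem conjDerivation_apply (σ : A ≃ₐ[R] A) (D : Derivation R A A) (a : A) :
    conjDerivation σ D a = σ (D (σ.symm a)) := rfl

/-- Conjugation by an automorphism of an algebra, as an automorphism of the Lie algebra of
derivations. -/
def conjLieEquiv (σ : A ≃ₐ[R] A) : Derivation R A A ≃ₗ⁅R⁆ Derivation R A A where
  toFun := conjDerivation σ
  map_add' D E := by ext; simp [conjDerivation_apply]
  map_smul' c D := by ext; simp [conjDerivation_apply]
  map_lie' {D E} := by ext; simp [Derivation.commutator_apply, conjDerivation_apply]
  invFun := conjDerivation σ.symm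
  left_inv D := by ext; simp [conjDerivation_apply]
  right_inv D := by ext; simp [conjDerivation_apply]

end Conjugation

section Automorphisms

variable {k : Type*} [Field k] {p : ℕ}

theorem exists_lieEquiv_of_substHom {y : TruncPoly k p} (hy : x k p ∣ y)
    (h1 : truncCoeff 1 y ≠ 0) :
    ∃ g : W k p ≃ₗ⁅k⁆ W k p, ∀ D : W k p, g D y = substHom hy (D (x k p)) := by
  let σ := AlgEquiv.ofBijective (substHom hy) (substHom_bijective hy h1)
  have hσ : σ.symm y = x k p := σ.symm_apply_eq.mpr (substHom_x hy).symm
  refine ⟨conjLieEquiv σ, fun D => ?_⟩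
  change σ (D (σ.symm y)) = _
  rw [hσ]
  rfl

variable (k p) in
/-- The elements `c` of the Witt algebra with `(ad c) ^ 2 = 0`. -/
def sandwich : Set (W k p) := {c | ∀ w : W k p, ⁅c, ⁅c, w⁆⁆ = 0}

theorem map_mem_sandwich (g : W k p ≃ₗ⁅k⁆ W k p) {c : W k p} (hc : c ∈ sandwich k p) :
    g c ∈ sandwich k p := by
  intro w
  obtain ⟨v, rfl⟩ : ∃ v, g v = w := g.surjective w
  rw [← LieEquiv.map_lie, ← LieEquiv.map_lie, hc v]
  exact map_zero g.toLinearEquiv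

variable [CharP k p]

theorem lie_lie_apply_x (c w : W k p) : ⁅c, ⁅c, w⁆⁆ (x k p) =
    c (x k p) * (c (x k p) * del k p (del k p (w (x k p))) -
      w (x k p) * del k p (del k p (c (x k p)))) -
    (c (x k p) * del k p (w (x k p)) - w (x k p) * del k p (c (x k p))) *
      del k p (c (x k p)) := by
  rw [lie_apply_x, lie_apply_x, map_sub, Derivation.leibniz, Derivation.leibniz]
  simp only [smul_eq_mul]
  ring

theorem eq_zero_of_two_mul_eq_zero (hp : 2 < p) {a : TruncPoly k p} (h : 2 * a = 0) : a = 0 := by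
  have h2 : (2 : k) ≠ 0 := natCast_ne_zero_of_lt two_ne_zero hp
  rw [two_mul, ← two_smul k] at h
  exact (smul_eq_zero.mp h).resolve_left h2

-- The equation `(ad c) ^ 2 w = 0` for `w = ∂, x∂, x ^ 2 ∂`, and a derivative of one of its
-- consequences.
theorem mul_self_eq_zero_of_mem_sandwich (hp : 2 < p) {c : W k p} (hc : c ∈ sandwich k p) :
    c (x k p) * c (x k p) = 0 ∧ del k p (c (x k p)) * del k p (c (x k p)) = 0 := by
  have e0 := congrArg (fun D : W k p => D (x k p)) (hc (del k p))
  have e1 := congrArg (fun D : W k p => D (x k p)) (hc (x k p • del k p))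
  have e2 := congrArg (fun D : W k p => D (x k p)) (hc (x k p ^ 2 • del k p))
  simp only [lie_lie_apply_x, smul_del_apply_x, del_x, Derivation.coe_zero, Pi.zero_apply,
    Derivation.map_one_eq_zero, Derivation.leibniz_pow, map_zero, nsmul_eq_mul, Nat.cast_ofNat,
    Nat.add_one_sub_one, pow_one, smul_eq_mul, mul_one, two_mul, map_add] at e0 e1 e2
  set f := c (x k p)
  set f' := del k p f
  have hff' : f * f' = 0 := by linear_combination -e1 + x k p * e0
  have hff'_del : f * del k p f' + f' * f' = 0 := by
    have := congrArg (del k p) hff'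
    rwa [Derivation.leibniz, map_zero, smul_eq_mul, smul_eq_mul] at this
  exact ⟨eq_zero_of_two_mul_eq_zero hp
      (by linear_combination e2 - x k p ^ 2 * e0 + 2 * x k p * hff'),
    eq_zero_of_two_mul_eq_zero hp (by linear_combination hff'_del + e0)⟩

theorem mem_sandwich_of_x_pow_dvd {n : ℕ} (hn : p ≤ 2 * (n - 1)) {c : W k p}
    (h : x k p ^ n ∣ c (x k p)) : c ∈ sandwich k p := by
  intro w
  have hd := x_pow_pred_dvd_del h
  apply W_ext
  rw [lie_lie_apply_x, Derivation.coe_zero, Pi.zero_apply]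
  linear_combination
    del k p (del k p (w (x k p))) * mul_eq_zero_of_x_pow_dvd (by lia) h h
      - w (x k p) * mul_eq_zero_of_x_pow_dvd (by lia) h (x_pow_pred_dvd_del hd)
      - del k p (w (x k p)) * mul_eq_zero_of_x_pow_dvd (by lia) h hd
      + w (x k p) * mul_eq_zero_of_x_pow_dvd (by lia) hd hd

theorem lie_x_pow_smul_del (m n : ℕ) : ⁅x k p ^ m • del k p, x k p ^ n • del k p⁆ =
    ((n : k) - m) • (x k p ^ (m + n - 1) • del k p) := by
  have h (m n : ℕ) : x k p ^ m * ((n : k) • x k p ^ (n - 1)) = (n : k) • x k p ^ (m + n - 1) := by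
    rcases n.eq_zero_or_pos with rfl | hn
    · simp
    · rw [mul_smul_comm, ← pow_add, Nat.add_sub_assoc hn]
  apply W_ext
  have hx (n : ℕ) : (x k p ^ n • del k p) (x k p) = x k p ^ n := smul_del_apply_x _
  rw [lie_apply_x, hx, hx, del_x_pow, del_x_pow, h, h, add_comm n m, Derivation.smul_apply, hx,
    sub_smul]

theorem lieEquiv_x_pow_smul_del_apply {g : W k p ≃ₗ⁅k⁆ W k p} {y : TruncPoly k p}
    (hE : g (x k p • del k p) = y • g (del k p)) (hD : g (del k p) y = 1) {n : ℕ} (hn : n < p) :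
    g (x k p ^ n • del k p) y = y ^ n := by
  induction n with
  | zero => rw [pow_zero, pow_zero, one_smul, hD]
  | succ n ih =>
    have hlie (m : ℕ) : ⁅g (x k p ^ m • del k p), g (x k p ^ (n + 1) • del k p)⁆ y =
        ((n + 1 : ℕ) - m : k) • g (x k p ^ (m + n) • del k p) y := by
      rw [← LieEquiv.map_lie, lie_x_pow_smul_del, map_smul, Derivation.smul_apply]
      rfl
    have h0 := hlie 0
    have h1 := hlie 1
    rw [pow_zero, one_smul, Derivation.commutator_apply, hD, Derivation.map_one_eq_zero, sub_zero,
      Nat.cast_zero, sub_zero, zero_add, ih (by lia)] at h0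
    rw [pow_one, Derivation.commutator_apply, hE, Derivation.smul_apply, Derivation.smul_apply, hD,
      h0, smul_eq_mul, smul_eq_mul, mul_one, mul_smul_comm, ← pow_succ', Nat.cast_one,
      Nat.cast_succ, add_sub_cancel_right, add_comm 1 n, sub_eq_iff_eq_add] at h1
    have hn0 : ((n + 1 : ℕ) : k) ≠ 0 := natCast_ne_zero_of_lt n.succ_ne_zero hn
    refine (smul_right_injective _ hn0 ?_).symm
    simp only [Nat.cast_succ]
    rw [h1, add_smul, one_smul]

variable [Fact p.Prime]

theorem mem_sandwich_iff (hp : 2 < p) {c : W k p} :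
    c ∈ sandwich k p ↔ x k p ^ ((p + 3) / 2) ∣ c (x k p) := by
  have := (Fact.out : p.Prime).eq_two_or_odd
  refine ⟨fun h => ?_, fun h => mem_sandwich_of_x_pow_dvd (by lia) h⟩
  obtain ⟨hff, hdd⟩ := mul_self_eq_zero_of_mem_sandwich hp h
  rcases eq_or_ne (c (x k p)) 0 with h0 | h0
  · rw [h0]
    exact dvd_zero _
  obtain ⟨s, hs⟩ := exists_hasOrder h0
  have hs0 := hs.le_add_of_mul_eq_zero hs hff
  have hds := hs.del (by lia)
  have hs1 := hds.le_add_of_mul_eq_zero hds hdd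
  exact (pow_dvd_pow _ (by lia)).trans hs.1

-- The maximal subalgebra `W_{≥ 0}` is the normalizer of the set of sandwich elements, hence
-- invariant under automorphisms.
theorem x_dvd_apply_x_iff (hp : 3 < p) (w : W k p) :
    x k p ∣ w (x k p) ↔ ∀ c ∈ sandwich k p, ⁅w, c⁆ ∈ sandwich k p := by
  have := (Fact.out : p.Prime).eq_two_or_odd
  obtain ⟨n, hn⟩ : ∃ n, n + 1 = (p + 3) / 2 := ⟨(p + 1) / 2, by lia⟩
  simp only [mem_sandwich_iff (show 2 < p by lia), lie_apply_x, ← hn]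
  constructor
  · intro h c hc
    refine dvd_sub ?_ (hc.mul_right _)
    have := x_pow_pred_dvd_del hc
    rw [Nat.add_sub_cancel] at this
    rw [pow_succ']
    exact mul_dvd_mul h this
  · intro h
    by_contra hw
    rw [x_dvd_iff] at hw
    have hx : HasOrder (n + 1) (x k p ^ (n + 1)) :=
      ⟨dvd_rfl, by simp [truncCoeff_x_pow (show n + 1 < p by lia)]⟩
    have hlie := h (x k p ^ (n + 1) • del k p) (by rw [smul_del_apply_x])
    rw [smul_del_apply_x, dvd_sub_left (dvd_mul_right _ _), x_pow_dvd_iff (by lia)] at hlie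
    have hdel := hx.del n.succ_ne_zero
    have := truncCoeff_add_mul (m := 0) (n := n) (by lia) (by simp) hdel.1 (a := w (x k p))
    rw [zero_add, hlie n n.lt_succ_self] at this
    exact mul_ne_zero hw hdel.2 this.symm

theorem x_dvd_map_apply_x (hp : 3 < p) (g : W k p ≃ₗ⁅k⁆ W k p) {w : W k p}
    (hw : x k p ∣ w (x k p)) : x k p ∣ g w (x k p) := by
  rw [x_dvd_apply_x_iff hp] at hw ⊢
  intro c hc
  have := map_mem_sandwich g (hw _ (map_mem_sandwich g.symm hc))
  rwa [LieEquiv.map_lie, LieEquiv.apply_symm_apply] at this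

theorem exists_lieEquiv_apply_eq_one (hp : 3 < p) (g : W k p ≃ₗ⁅k⁆ W k p) :
    ∃ y, x k p ∣ y ∧ g (x k p • del k p) = y • g (del k p) ∧ g (del k p) y = 1 := by
  set D := g (del k p) with hD
  set E := g (x k p • del k p) with hE
  have hD0 : truncCoeff 0 (D (x k p)) ≠ 0 := fun h0 => by
    have := x_dvd_map_apply_x hp g.symm (x_dvd_iff.mpr h0)
    rw [hD, LieEquiv.symm_apply_apply, del_x, x_dvd_iff, truncCoeff_zero_one] at this
    exact one_ne_zero this
  have hE0 : x k p ∣ E (x k p) := x_dvd_map_apply_x hp g (by rw [smul_del_apply_x])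
  obtain ⟨u, hu⟩ := (isUnit_of_truncCoeff_zero_ne hD0).exists_right_inv
  have hED : E = (E (x k p) * u) • D := W_ext k p (by
    rw [Derivation.smul_apply, smul_eq_mul]
    linear_combination -E (x k p) * hu)
  refine ⟨E (x k p) * u, hE0.mul_right u, hED, ?_⟩
  set y := E (x k p) * u
  have hlie : ⁅D, E⁆ (x k p) = D (x k p) := by
    have h := lie_x_pow_smul_del (k := k) (p := p) 0 1
    rw [pow_zero, one_smul, pow_one, Nat.cast_one, Nat.cast_zero, sub_zero,
      one_smul] at h
    rw [hD, hE, ← LieEquiv.map_lie, h]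
  rw [hED, Derivation.commutator_apply, Derivation.smul_apply, Derivation.smul_apply,
    smul_eq_mul, smul_eq_mul, Derivation.leibniz, smul_eq_mul, smul_eq_mul,
    add_sub_cancel_left] at hlie
  linear_combination u * hlie + (1 - D y) * hu

theorem exists_substHom_of_lieEquiv (hp : 3 < p) (g : W k p ≃ₗ⁅k⁆ W k p) :
    ∃ (y : TruncPoly k p) (hy : x k p ∣ y), truncCoeff 1 y ≠ 0 ∧
      ∀ D : W k p, g D y = substHom hy (D (x k p)) := by
  obtain ⟨y, hy, hE, hD⟩ := exists_lieEquiv_apply_eq_one hp g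
  refine ⟨y, hy, fun h1 => ?_, fun D => ?_⟩
  · rw [derivation_apply] at hD
    have := congrArg (truncCoeff 0) hD
    rw [truncCoeff_zero_mul, truncCoeff_zero_del, h1, mul_zero, truncCoeff_zero_one] at this
    exact zero_ne_one this
  · have : LinearMap.mulRight k (del k p y) ∘ₗ (evalX k p).toLinearMap ∘ₗ
        g.toLinearEquiv.toLinearMap =
        (substHom hy).toLinearMap ∘ₗ (evalX k p).toLinearMap := by
      refine (basis k p).ext fun n => ?_
      change g (basis k p n) (x k p) * del k p y = substHom hy (basis k p n (x k p))
      rw [← derivation_apply, basis_apply, lieEquiv_x_pow_smul_del_apply hE hD n.2,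
        smul_del_apply_x, map_pow, substHom_x]
    rw [derivation_apply]
    exact LinearMap.congr_fun this D

end Automorphisms

section Orbits

variable {k : Type*} [Field k] {p : ℕ} {χ ψ ω : Module.Dual k (W k p)}

theorem mem_orbit_self (χ : Module.Dual k (W k p)) : χ ∈ orbit χ :=
  ⟨LieEquiv.refl, rfl⟩

theorem mem_orbit_symm (h : ψ ∈ orbit χ) : χ ∈ orbit ψ := by
  obtain ⟨g, rfl⟩ := h
  refine ⟨g.symm, LinearMap.ext fun w => ?_⟩
  rw [act_apply, act_apply, LieEquiv.symm_symm, LieEquiv.symm_apply_apply]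

theorem mem_orbit_trans (h : ψ ∈ orbit χ) (h' : ω ∈ orbit ψ) : ω ∈ orbit χ := by
  obtain ⟨g, rfl⟩ := h
  obtain ⟨g', rfl⟩ := h'
  exact ⟨g.trans g', rfl⟩

end Orbits

section Characters

variable {k : Type*} [Field k] {p : ℕ}

/-- The element of `k[X] / (X ^ p)` whose coefficients are the entries of `u` in reverse order. -/
def ofCoords (u : Fin p → k) : TruncPoly k p := ∑ j : Fin p, u j.rev • x k p ^ (j : ℕ)

theorem truncCoeff_ofCoords (u : Fin p → k) (j : Fin p) : truncCoeff j (ofCoords u) = u j.rev := by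
  simp [ofCoords, truncCoeff_x_pow j.2, Fin.val_inj]

variable [CharP k p]

theorem truncCoeff_pred_mul_basis (q : TruncPoly k p) (m : Fin p) :
    truncCoeff (p - 1) (q * basis k p m (x k p)) = truncCoeff m.rev q := by
  have hm : p - 1 = m + m.rev := by grind
  rw [basis_apply, smul_del_apply_x, mul_comm, hm, truncCoeff_add_x_pow_mul (by grind)]

/-- The functional `f ∂ ↦ Res (x ^ (-p) q f dx)` on the Witt algebra, as a function of `q`. Under
automorphisms of the Witt algebra, `q` transforms like a quadratic differential. -/
def residueEquiv : TruncPoly k p ≃ₗ[k] Module.Dual k (W k p) where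
  toFun q := truncCoeff (p - 1) ∘ₗ LinearMap.mulLeft k q ∘ₗ (evalX k p).toLinearMap
  map_add' q r := by ext; simp [add_mul]
  map_smul' a q := by ext; simp
  invFun χ := ofCoords (coords χ)
  left_inv q := ext_truncCoeff fun n hn => by
    rw [truncCoeff_ofCoords _ ⟨n, hn⟩]
    exact (truncCoeff_pred_mul_basis q _).trans (by rw [Fin.rev_rev])
  right_inv χ := (basis k p).ext fun m =>
    (truncCoeff_pred_mul_basis _ m).trans (by rw [truncCoeff_ofCoords, Fin.rev_rev]; rfl)

theorem residueEquiv_apply (q : TruncPoly k p) (D : W k p) :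
    residueEquiv q D = truncCoeff (p - 1) (q * D (x k p)) := rfl

theorem coords_residueEquiv (q : TruncPoly k p) (m : Fin p) :
    coords (residueEquiv q) m = truncCoeff m.rev q :=
  truncCoeff_pred_mul_basis q m

theorem residueEquiv_e (q : TruncPoly k p) {j : ℤ} {n : ℕ} (h : j + n + 2 = p) (hj : -1 ≤ j) :
    residueEquiv q (e k p j) = truncCoeff n q := by
  have hn : p - 1 = (j + 1).toNat + n := by lia
  rw [residueEquiv_apply, e, if_pos (by lia), smul_del_apply_x, mul_comm, hn,
    truncCoeff_add_x_pow_mul (by lia)]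

theorem e'_eq_residueEquiv {j : ℤ} {n : ℕ} (h : j + n + 2 = p) (hj : -1 ≤ j) :
    e' k p j = residueEquiv (x k p ^ n) := by
  refine (basis k p).ext fun m => ?_
  rw [residueEquiv_apply, truncCoeff_pred_mul_basis, truncCoeff_x_pow m.rev.2, e',
    dif_pos (by lia), Module.Basis.coord_apply, Module.Basis.repr_self, Finsupp.single_apply]
  refine if_congr ?_ rfl rfl
  rw [Fin.ext_iff]
  grind

section Height

theorem forall_mem_Wge_residueEquiv_eq_zero_iff {q : TruncPoly k p} {i : ℤ} {n : ℕ}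
    (h : i + n + 1 = p) (hi : -1 ≤ i) :
    (∀ w ∈ Wge k p i, residueEquiv q w = 0) ↔ x k p ^ n ∣ q := by
  change Wge k p i ≤ LinearMap.ker (residueEquiv q) ↔ _
  rw [x_pow_dvd_iff (by lia), Wge, Submodule.span_le]
  constructor
  · intro hq m hm
    rw [← residueEquiv_e q (show (p - 2 - m : ℤ) + m + 2 = p by ring) (by lia)]
    exact hq ⟨_, by lia, by lia, by lia, rfl⟩
  · rintro hq _ ⟨j, hj, hij, hjp, rfl⟩
    obtain ⟨m, hm⟩ : ∃ m : ℕ, j + m + 2 = p := ⟨(p - 2 - j).toNat, by lia⟩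
    exact (residueEquiv_e q hm hj).trans (hq m (by lia))

theorem height_zero [NeZero p] : height (0 : Module.Dual k (W k p)) = -1 := by
  have hp : 0 < p := NeZero.pos p
  rw [height, if_pos (LinearMap.zero_apply _)]
  exact IsLeast.csInf_eq ⟨⟨le_rfl, by lia, fun _ _ => rfl⟩, fun i hi => hi.1⟩

theorem HasOrder.height_residueEquiv {q : TruncPoly k p} {n : ℕ} (h : HasOrder n q) :
    height (residueEquiv q) = (p : ℤ) - 1 - n := by
  have hn := h.lt
  rw [height, residueEquiv_e q (n := 0) (by simp) (by lia)]
  rcases Nat.eq_zero_or_pos n with rfl | hn0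
  · rw [if_neg h.2]
    simp
  rw [if_pos ((x_pow_dvd_iff hn.le).mp h.1 0 hn0)]
  refine IsLeast.csInf_eq ⟨⟨by lia, by lia, ?_⟩, fun i ⟨hi, _, hq⟩ => ?_⟩
  · exact (forall_mem_Wge_residueEquiv_eq_zero_iff (by lia) (by lia)).mpr h.1
  · by_contra! hlt
    obtain ⟨m, hm⟩ : ∃ m : ℕ, i + m + 1 = p := ⟨(p - 1 - i).toNat, by lia⟩
    have hdvd := (forall_mem_Wge_residueEquiv_eq_zero_iff hm hi).mp hq
    exact h.2 ((x_pow_dvd_iff (by lia)).mp hdvd n (by lia))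

theorem height_residueEquiv_eq_iff [NeZero p] {q : TruncPoly k p} {i : ℤ} {n : ℕ}
    (h : i + n + 1 = p) (hi : 0 ≤ i) : height (residueEquiv q) = i ↔ HasOrder n q := by
  refine ⟨fun hq => ?_, fun hq => by rw [hq.height_residueEquiv]; lia⟩
  rcases eq_or_ne q 0 with rfl | hq0
  · rw [map_zero, height_zero] at hq
    lia
  · obtain ⟨m, hm⟩ := exists_hasOrder hq0
    rw [hm.height_residueEquiv] at hq
    rwa [show n = m by lia]

end Height

section Twist

variable {y : TruncPoly k p}

/-- The transform `q(y) (dy/dx) ^ 2 dx ^ 2` of the quadratic differential `q dx ^ 2` under the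
substitution `x ↦ y`, multiplied by the constant that makes it correspond, through `residueEquiv`,
to the action of an automorphism. -/
def twist (hy : x k p ∣ y) : TruncPoly k p →ₗ[k] TruncPoly k p :=
  (truncCoeff 1 y ^ p)⁻¹ • LinearMap.mulRight k (del k p y ^ 2) ∘ₗ (substHom hy).toLinearMap

theorem twist_apply (hy : x k p ∣ y) (q : TruncPoly k p) :
    twist hy q = (truncCoeff 1 y ^ p)⁻¹ • (substHom hy q * del k p y ^ 2) := rfl

theorem x_pow_dvd_twist (hy : x k p ∣ y) {n : ℕ} {q : TruncPoly k p} (h : x k p ^ n ∣ q) :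
    x k p ^ n ∣ twist hy q := by
  rw [twist_apply]
  exact dvd_smul_of_dvd _ ((x_pow_dvd_substHom hy h).mul_right _)

theorem truncCoeff_twist (hy : x k p ∣ y) {n : ℕ} (hn : n < p) {q : TruncPoly k p}
    (h : x k p ^ n ∣ q) :
    truncCoeff n (twist hy q) =
      (truncCoeff 1 y ^ p)⁻¹ * truncCoeff 1 y ^ (n + 2) * truncCoeff n q := by
  have : NeZero p := ⟨by lia⟩
  have := truncCoeff_add_mul (n := 0) hn (x_pow_dvd_substHom hy h) (b := del k p y ^ 2) (by simp)
  rw [add_zero, truncCoeff_substHom hy hn h, truncCoeff_zero_pow, truncCoeff_zero_del] at this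
  rw [twist_apply, map_smul, this, smul_eq_mul]
  ring

theorem HasOrder.twist {n : ℕ} {q : TruncPoly k p} (h : HasOrder n q) (hy : x k p ∣ y)
    (h1 : truncCoeff 1 y ≠ 0) : HasOrder n (twist hy q) := by
  refine ⟨x_pow_dvd_twist hy h.1, ?_⟩
  rw [truncCoeff_twist hy h.lt h.1]
  exact mul_ne_zero (by positivity) h.2

theorem residueEquiv_twist_apply [NeZero p] (hy : x k p ∣ y) (h1 : truncCoeff 1 y ≠ 0)
    (q : TruncPoly k p) {D E : W k p} (h : D y = substHom hy (E (x k p))) :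
    residueEquiv (WittAlgebra.twist hy q) D = residueEquiv q E := by
  have hres := truncCoeff_pred_substHom_mul_del hy (q * E (x k p))
  rw [map_mul (substHom hy), ← h, derivation_apply D] at hres
  rw [residueEquiv_apply, residueEquiv_apply, twist_apply, smul_mul_assoc, map_smul, smul_eq_mul,
    inv_mul_eq_iff_eq_mul₀ (pow_ne_zero p h1), ← hres]
  congr 1
  ring

variable [Fact p.Prime]

theorem mem_orbit_residueEquiv_iff (hp : 3 < p) {q : TruncPoly k p} {ψ : Module.Dual k (W k p)} :
    ψ ∈ orbit (residueEquiv q) ↔ ∃ (y : TruncPoly k p) (hy : x k p ∣ y),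
      truncCoeff 1 y ≠ 0 ∧ ψ = residueEquiv (twist hy q) := by
  have key {y : TruncPoly k p} (hy : x k p ∣ y) (h1 : truncCoeff 1 y ≠ 0)
      {g : W k p ≃ₗ⁅k⁆ W k p} (hg : ∀ D : W k p, g D y = substHom hy (D (x k p))) :
      act g (residueEquiv q) = residueEquiv (twist hy q) := by
    refine LinearMap.ext fun D => (residueEquiv_twist_apply hy h1 q ?_).symm
    exact (congrArg (· y) (g.apply_symm_apply D)).symm.trans (hg _)
  constructor
  · rintro ⟨g, rfl⟩
    obtain ⟨y, hy, h1, hg⟩ := exists_substHom_of_lieEquiv hp g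
    exact ⟨y, hy, h1, key hy h1 hg⟩
  · rintro ⟨y, hy, h1, rfl⟩
    obtain ⟨g, hg⟩ := exists_lieEquiv_of_substHom hy h1
    exact ⟨g, (key hy h1 hg).symm⟩

theorem height_eq_of_mem_orbit (hp : 3 < p) {χ ψ : Module.Dual k (W k p)} (h : ψ ∈ orbit χ) :
    height ψ = height χ := by
  obtain ⟨q, rfl⟩ := residueEquiv.surjective χ
  obtain ⟨y, hy, h1, rfl⟩ := (mem_orbit_residueEquiv_iff hp).mp h
  rcases eq_or_ne q 0 with rfl | hq
  · rw [map_zero]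
  · obtain ⟨n, hn⟩ := exists_hasOrder hq
    rw [hn.height_residueEquiv, (hn.twist hy h1).height_residueEquiv]

end Twist

end Characters

section Elimination

variable {k : Type*} [Field k] {p : ℕ} {n s : ℕ}

theorem x_pow_succ_dvd_sub_smul (m : ℕ) {a : TruncPoly k p} (h : x k p ^ m ∣ a) :
    x k p ^ (m + 1) ∣ a - truncCoeff m a • x k p ^ m := by
  rcases le_or_gt p m with hm | hm
  · rw [x_pow_eq_zero hm] at h ⊢
    rw [zero_dvd_iff.mp h]
    simp
  · refine (x_pow_dvd_iff hm).mpr fun j hj => ?_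
    rw [map_sub, map_smul, truncCoeff_x_pow (by lia), smul_eq_mul, mul_ite, mul_one, mul_zero]
    split_ifs with hjm
    · rw [hjm, sub_self]
    · rw [(x_pow_dvd_iff hm.le).mp h j (by lia), sub_zero]

theorem x_dvd_x_add_smul (t : k) (s : ℕ) : x k p ∣ x k p + t • x k p ^ (s + 1) :=
  dvd_add dvd_rfl (dvd_smul_of_dvd t (dvd_pow_self _ s.succ_ne_zero))

theorem truncCoeff_one_x_add_smul (hp : 1 < p) (hs : 0 < s) (t : k) :
    truncCoeff 1 (x k p + t • x k p ^ (s + 1)) = 1 := by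
  rw [map_add, map_smul, truncCoeff_x_pow hp, if_neg (by lia), smul_zero, add_zero]
  simpa using truncCoeff_x_pow (k := k) hp 1

theorem x_pow_dvd_twist_sub [Fact p.Prime] [CharP k p] (hs : 0 < s) (t : k) {q : TruncPoly k p}
    (hq : HasOrder n q) :
    x k p ^ (n + s + 1) ∣ twist (x_dvd_x_add_smul t s) q -
      (q + (t * ((n + 2 * (s + 1) : ℕ) : k) * truncCoeff n q) • x k p ^ (n + s)) := by
  obtain ⟨s, rfl⟩ : ∃ r, s = r + 1 := ⟨s - 1, by lia⟩
  obtain ⟨u, rfl, hu⟩ := exists_eq_x_pow_mul hq.lt hq.1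
  obtain ⟨b, hb⟩ := exists_eq_smul_one_add_x_mul u
  obtain ⟨v, hv⟩ := sub_dvd_substHom_sub (x_dvd_x_add_smul t (s + 1)) u
  set T := algebraMap k (TruncPoly k p) t
  have hy : x k p + t • x k p ^ (s + 1 + 1) = x k p * (1 + T * x k p ^ (s + 1)) := by
    rw [Algebra.smul_def]
    ring
  have hdel : del k p (x k p + t • x k p ^ (s + 1 + 1)) = 1 + (s + 2) * T * x k p ^ (s + 1) := by
    rw [map_add, Derivation.map_smul, del_x, del_x_pow, Nat.add_sub_cancel, Algebra.smul_def,
      Algebra.smul_def, map_natCast]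
    push_cast
    ring
  obtain ⟨c, hc⟩ := Polynomial.powAddExpansion (1 : TruncPoly k p) (T * x k p ^ (s + 1)) n
  rw [one_pow, one_pow, mul_one] at hc
  have hsubst : substHom (x_dvd_x_add_smul t (s + 1)) u = u + T * x k p ^ (s + 2) * v := by
    rw [← sub_eq_iff_eq_add', hv, Algebra.smul_def]
    ring
  have hcoeff : algebraMap k _ (truncCoeff n (x k p ^ n * u)) = u - x k p * b := by
    rw [← hu, Algebra.algebraMap_eq_smul_one, eq_sub_iff_add_eq, ← hb]
  have hp := (Fact.out : p.Prime).one_lt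
  rw [twist_apply, truncCoeff_one_x_add_smul hp hs, one_pow, inv_one, one_smul, map_mul, map_pow,
    substHom_x, hsubst, hdel, hy, mul_pow, hc, Algebra.smul_def, map_mul, map_mul, map_natCast,
    hcoeff]
  refine ⟨(n + 2 * (s + 2)) * T * b + x k p ^ s * T ^ 2 * (c + 2 * n * (s + 2) + (s + 2) ^ 2 +
    x k p ^ (s + 1) * T * (2 * (s + 2) * c + n * (s + 2) ^ 2) +
    x k p ^ (2 * s + 2) * T ^ 2 * (s + 2) ^ 2 * c) * u +
    (1 + n * (T * x k p ^ (s + 1)) + c * (T * x k p ^ (s + 1)) ^ 2) *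
      (1 + (s + 2) * T * x k p ^ (s + 1)) ^ 2 * T * v, ?_⟩
  push_cast
  ring

variable [Fact p.Prime] [CharP k p]

theorem exists_mem_orbit_x_pow_dvd_sub (hp : 3 < p) (hs : 0 < s)
    (hns : ((n + 2 * (s + 1) : ℕ) : k) ≠ 0) {q : TruncPoly k p} (hq : HasOrder n q) (c : k) :
    ∃ r, residueEquiv r ∈ orbit (residueEquiv q) ∧ HasOrder n r ∧
      truncCoeff n r = truncCoeff n q ∧ x k p ^ (n + s + 1) ∣ r - (q + c • x k p ^ (n + s)) := by
  set t := c * (((n + 2 * (s + 1) : ℕ) : k) * truncCoeff n q)⁻¹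
  have h1 : truncCoeff 1 (x k p + t • x k p ^ (s + 1)) = 1 :=
    truncCoeff_one_x_add_smul (by lia) hs t
  have h1' : truncCoeff 1 (x k p + t • x k p ^ (s + 1)) ≠ 0 := h1 ▸ one_ne_zero
  refine ⟨twist (x_dvd_x_add_smul t s) q,
    (mem_orbit_residueEquiv_iff hp).mpr ⟨_, x_dvd_x_add_smul t s, h1', rfl⟩,
    hq.twist _ h1', ?_, ?_⟩
  · rw [truncCoeff_twist _ hq.lt hq.1, h1]
    simp
  · have := x_pow_dvd_twist_sub hs t hq
    rwa [mul_assoc, inv_mul_cancel_right₀ (mul_ne_zero hns hq.2)] at this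

-- The coefficient of `x ^ (n + s)` is not removed, since the substitutions `x ↦ x + t x ^ (s + 1)`
-- fix it to first order when `n + 2 (s + 1) = 0` in `k`.
theorem exists_mem_orbit_add (hp : 3 < p)
    (hs : ∀ m, 0 < m → n + m < p → m ≠ s → ((n + 2 * (m + 1) : ℕ) : k) ≠ 0)
    {q : TruncPoly k p} (hq : HasOrder n q) :
    ∃ β : k, residueEquiv (truncCoeff n q • x k p ^ n + β • x k p ^ (n + s)) ∈
      orbit (residueEquiv q) := by
  have key (m : ℕ) : ∃ (r : TruncPoly k p) (β : k), residueEquiv r ∈ orbit (residueEquiv q) ∧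
      HasOrder n r ∧ truncCoeff n r = truncCoeff n q ∧
      x k p ^ (n + m + 1) ∣ r - (truncCoeff n q • x k p ^ n + β • x k p ^ (n + s)) := by
    induction m with
    | zero =>
      refine ⟨q, 0, mem_orbit_self _, hq, rfl, ?_⟩
      simpa only [zero_smul, add_zero] using x_pow_succ_dvd_sub_smul n hq.1
    | succ m ih =>
      obtain ⟨r, β, hr, hrn, hrq, hd⟩ := ih
      rw [add_assoc n m 1] at hd
      have hd' := x_pow_succ_dvd_sub_smul _ hd
      set c := truncCoeff (n + (m + 1)) (r - (truncCoeff n q • x k p ^ n + β • x k p ^ (n + s)))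
      rcases le_or_gt p (n + (m + 1)) with hmp | hmp
      · refine ⟨r, β, hr, hrn, hrq, ?_⟩
        rwa [x_pow_eq_zero hmp, smul_zero, sub_zero] at hd'
      rcases eq_or_ne (m + 1) s with rfl | hms
      · refine ⟨r, β + c, hr, hrn, hrq, ?_⟩
        rwa [add_smul, ← add_assoc (truncCoeff n q • x k p ^ n), ← sub_sub]
      · obtain ⟨r', hr', hrn', hrq', hd₁⟩ := exists_mem_orbit_x_pow_dvd_sub hp m.succ_pos
          (hs (m + 1) m.succ_pos hmp hms) hrn (-c)
        refine ⟨r', β, mem_orbit_trans hr hr', hrn', hrq'.trans hrq, ?_⟩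
        convert dvd_add hd₁ hd' using 1
        rw [neg_smul, Nat.succ_eq_add_one]
        abel
  obtain ⟨r, β, hr, -, -, hd⟩ := key p
  rw [x_pow_eq_zero (by lia), zero_dvd_iff, sub_eq_zero] at hd
  exact ⟨β, by rwa [← hd]⟩

end Elimination

section SquareRoot

variable {k : Type*} [Field k] {p n : ℕ}

theorem truncCoeff_smul_sq (hn : n < p) (α : k) {r : TruncPoly k p} (hr : truncCoeff 0 r = 1) :
    truncCoeff n (α • (x k p ^ n * r ^ 2)) = α := by
  have : NeZero p := ⟨by lia⟩
  rw [map_smul, truncCoeff_x_pow_mul_self hn, truncCoeff_zero_pow, hr, one_pow, smul_eq_mul,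
    mul_one]

theorem hasOrder_smul_sq (hn : n < p) {α : k} (hα : α ≠ 0) {r : TruncPoly k p}
    (hr : truncCoeff 0 r = 1) : HasOrder n (α • (x k p ^ n * r ^ 2)) :=
  ⟨dvd_smul_of_dvd α (dvd_mul_right _ _), by rwa [truncCoeff_smul_sq hn α hr]⟩

theorem x_pow_mul_sum_truncCoeff_add (hn : n < p) {q : TruncPoly k p} (hq : x k p ^ n ∣ q) :
    x k p ^ n * ∑ j ∈ Finset.range p, truncCoeff (n + j) q • x k p ^ j = q := by
  have : NeZero p := ⟨by lia⟩
  obtain ⟨u, rfl⟩ := hq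
  conv_rhs => rw [eq_sum_truncCoeff_smul u]
  rw [Finset.mul_sum, Finset.mul_sum]
  refine Finset.sum_congr rfl fun j _ => ?_
  rw [mul_smul_comm, mul_smul_comm, ← pow_add]
  rcases lt_or_ge (n + j) p with h | h
  · rw [truncCoeff_add_x_pow_mul h]
  · rw [x_pow_eq_zero h, smul_zero, smul_zero]

theorem two_ne_zero_of_char_ne [CharP k p] (hp : p ≠ 2) : (2 : k) ≠ 0 :=
  Ring.two_ne_zero (by rwa [ringChar.eq k p])

variable [Fact p.Prime] [CharP k p]

theorem pow_half_sq (hp : p ≠ 2) {w : TruncPoly k p} (hw : truncCoeff 0 w = 1) :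
    (w ^ ((p + 1) / 2)) ^ 2 = w := by
  have := (Fact.out : p.Prime).eq_two_or_odd
  rw [← pow_mul, show (p + 1) / 2 * 2 = p + 1 by lia, pow_succ, pow_char_eq, hw, one_pow, one_smul,
    one_mul]

/-- The square root, with constant term `1`, of the cofactor of `x ^ n` in an element `q` of order
`n`, divided by its constant term. A unit with constant term `1` is the square of its power with
exponent `(p + 1) / 2`. -/
def sqrtUnit (n : ℕ) (q : TruncPoly k p) : TruncPoly k p :=
  ((truncCoeff n q)⁻¹ • ∑ j ∈ Finset.range p, truncCoeff (n + j) q • x k p ^ j) ^ ((p + 1) / 2)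

theorem HasOrder.sqrtUnit_spec (hp : p ≠ 2) {q : TruncPoly k p} (hq : HasOrder n q) :
    truncCoeff 0 (sqrtUnit n q) = 1 ∧
      truncCoeff n q • (x k p ^ n * sqrtUnit n q ^ 2) = q := by
  set u := ∑ j ∈ Finset.range p, truncCoeff (n + j) q • x k p ^ j with hu
  have hxu : x k p ^ n * u = q := x_pow_mul_sum_truncCoeff_add hq.lt hq.1
  have hw : truncCoeff 0 ((truncCoeff n q)⁻¹ • u) = 1 := by
    rw [map_smul, ← truncCoeff_x_pow_mul_self hq.lt, hxu, smul_eq_mul, inv_mul_cancel₀ hq.2]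
  refine ⟨?_, ?_⟩
  · rw [sqrtUnit, ← hu, truncCoeff_zero_pow, hw, one_pow]
  · rw [sqrtUnit, ← hu, pow_half_sq hp hw, mul_smul_comm, smul_inv_smul₀ hq.2, hxu]

theorem smul_sq_inj (hp : p ≠ 2) (hn : n < p) {α α' : k} (hα : α ≠ 0) {r r' : TruncPoly k p}
    (hr : truncCoeff 0 r = 1) (hr' : truncCoeff 0 r' = 1)
    (h : α • (x k p ^ n * r ^ 2) = α' • (x k p ^ n * r' ^ 2)) :
    α = α' ∧ ∀ s, n + s < p → truncCoeff s r = truncCoeff s r' := by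
  obtain rfl : α = α' := by rw [← truncCoeff_smul_sq hn α hr, h, truncCoeff_smul_sq hn α' hr']
  have hadd : truncCoeff 0 (r + r') ≠ 0 := by
    rw [map_add, hr, hr', one_add_one_eq_two]
    exact two_ne_zero_of_char_ne hp
  obtain ⟨u, hu⟩ := (isUnit_of_truncCoeff_zero_ne hadd).exists_right_inv
  have hsq := smul_right_injective _ hα h
  have hmul : x k p ^ n * r = x k p ^ n * r' := by
    linear_combination u * hsq - x k p ^ n * (r - r') * hu
  refine ⟨rfl, fun s hs => ?_⟩
  rw [← truncCoeff_add_x_pow_mul hs, hmul, truncCoeff_add_x_pow_mul hs]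

end SquareRoot

section NormalForm

variable {k : Type*} [Field k] {p n i s : ℕ}

/-- The representative with constant `a` of the quadratic differentials that vanish to order `n` at
`x = 0`. The exponent `s` is the one for which the coefficient of `x ^ (n + s)` cannot be removed
by substitutions. -/
def normalForm (k : Type*) [Field k] (p n s : ℕ) (a : k) : TruncPoly k p :=
  x k p ^ n + a • x k p ^ (n + s)

theorem normalForm_zero (n s : ℕ) : normalForm k p n s 0 = x k p ^ n := by
  rw [normalForm, zero_smul, add_zero]

theorem truncCoeff_one_smul_x (hp : 1 < p) (c : k) : truncCoeff 1 (c • x k p) = c := by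
  simpa using congrArg (c • ·) (truncCoeff_x_pow (k := k) hp 1)

theorem exists_eq_smul_x_mul (hp : 1 < p) {y : TruncPoly k p} (hy : x k p ∣ y)
    (hb : truncCoeff 1 y ≠ 0) :
    ∃ θ, y = truncCoeff 1 y • (x k p * θ) ∧ truncCoeff 0 θ = 1 := by
  obtain ⟨u, hu, hu0⟩ := exists_eq_x_pow_mul hp ((pow_one (x k p)).symm ▸ hy)
  refine ⟨(truncCoeff 1 y)⁻¹ • u, ?_, ?_⟩
  · rw [mul_smul_comm, smul_inv_smul₀ hb, ← pow_one (x k p), ← hu]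
  · rw [map_smul, hu0, smul_eq_mul, inv_mul_cancel₀ hb]

variable [CharP k p]

theorem twist_smul_x {c : k} (hy : x k p ∣ c • x k p) (hp : 1 < p) (n : ℕ) :
    twist hy (x k p ^ n) = ((c ^ p)⁻¹ * c ^ (n + 2)) • x k p ^ n := by
  rw [twist_apply, truncCoeff_one_smul_x hp, map_pow, substHom_x, Derivation.map_smul, del_x]
  simp only [Algebra.smul_def, map_mul, map_pow]
  ring

variable [Fact p.Prime]

theorem natCast_ne_zero_of_ne (hp : p ≠ 2) (hn : n + i + 1 = p)
    (hs : 2 * s + 1 = i ∨ 2 * s + 1 = i + p) {m : ℕ} (hm : n + m < p) (hms : m ≠ s) :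
    ((n + 2 * (m + 1) : ℕ) : k) ≠ 0 := by
  have hprime : Prime (p : ℤ) := Nat.prime_iff_prime_int.mp Fact.out
  rw [Ne, CharP.cast_eq_zero_iff k p, ← Int.natCast_dvd_natCast]
  intro h
  have h2 : (p : ℤ) ∣ 2 * (m - s) := by
    rcases hs with hs | hs
    · rw [show 2 * (m - s : ℤ) = (n + 2 * (m + 1) : ℕ) - p by lia]
      exact dvd_sub h dvd_rfl
    · rw [show 2 * (m - s : ℤ) = (n + 2 * (m + 1) : ℕ) - 2 * p by lia]
      exact dvd_sub h (dvd_mul_left _ 2)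
  rcases hprime.dvd_or_dvd h2 with h2 | h2
  · have := Int.le_of_dvd two_pos h2
    have := (Fact.out : p.Prime).two_le
    lia
  · have := Int.eq_zero_of_abs_lt_dvd h2 (abs_lt.mpr ⟨by lia, by lia⟩)
    lia

theorem normalForm_mem_orbit_smul_add (hp : 3 < p) (hn : n + i + 1 = p) {α β c : k} (hc : c ≠ 0)
    (h : c ^ i = c * α) :
    residueEquiv (normalForm k p n s (β * c ^ s * α⁻¹)) ∈
      orbit (residueEquiv (α • x k p ^ n + β • x k p ^ (n + s))) := by
  have hα : α ≠ 0 := right_ne_zero_of_mul (h ▸ pow_ne_zero i hc)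
  have hy : x k p ∣ c • x k p := dvd_smul_of_dvd c dvd_rfl
  have hlead : (c ^ p)⁻¹ * c ^ (n + 2) = α⁻¹ := by
    rw [← hn, add_right_comm, pow_add, h]
    field_simp
    ring
  refine (mem_orbit_residueEquiv_iff hp).mpr ⟨c • x k p, hy,
    by rwa [truncCoeff_one_smul_x (by lia)], ?_⟩
  rw [map_add, map_smul, map_smul, twist_smul_x hy (by lia), twist_smul_x hy (by lia),
    show n + s + 2 = n + 2 + s by ring, pow_add c (n + 2), ← mul_assoc, hlead, smul_smul, smul_smul,
    mul_inv_cancel₀ hα, one_smul, normalForm,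
    mul_right_comm, mul_assoc β]

theorem normalForm_eq_smul_sq (hp : p ≠ 2) (hs : 0 < s) (hsp : s < p) (n : ℕ) (a : k) :
    ∃ r : TruncPoly k p, truncCoeff 0 r = 1 ∧ truncCoeff s r = 2⁻¹ * a ∧
      normalForm k p n s a = (1 : k) • (x k p ^ n * r ^ 2) := by
  have := (Fact.out : p.Prime).eq_two_or_odd
  have hw : truncCoeff 0 (1 + a • x k p ^ s) = 1 := by
    rw [map_add, truncCoeff_zero_one, map_smul, truncCoeff_x_pow (by lia), if_neg hs.ne, smul_zero,
      add_zero]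
  have hhalf : (((p + 1) / 2 : ℕ) : k) = 2⁻¹ := by
    have hmul : (((p + 1) / 2 * 2 : ℕ) : k) = 1 := by
      rw [show (p + 1) / 2 * 2 = p + 1 by lia, Nat.cast_succ, CharP.cast_eq_zero, zero_add]
    exact (mul_eq_one_iff_eq_inv₀ (two_ne_zero_of_char_ne hp)).mp (by exact_mod_cast hmul)
  obtain ⟨c, hc⟩ :=
    Polynomial.powAddExpansion (1 : TruncPoly k p) (a • x k p ^ s) ((p + 1) / 2)
  have hpow : (1 + a • x k p ^ s) ^ ((p + 1) / 2) =
      1 + (2⁻¹ * a) • x k p ^ s + x k p ^ (s + s) * (a ^ 2 • c) := by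
    rw [hc, one_pow, one_pow, mul_one, ← hhalf]
    simp only [Algebra.smul_def, map_mul, map_pow, map_natCast]
    ring
  refine ⟨(1 + a • x k p ^ s) ^ ((p + 1) / 2), ?_, ?_, ?_⟩
  · rw [truncCoeff_zero_pow, hw, one_pow]
  · rw [hpow, map_add, map_add, truncCoeff_x_pow_mul_of_lt (by lia) hsp, map_smul,
      truncCoeff_x_pow hsp, if_pos rfl, ← pow_zero (x k p), truncCoeff_x_pow hsp, if_neg hs.ne']
    simp
  · rw [pow_half_sq hp hw, normalForm, one_smul, mul_add, mul_one, mul_smul_comm, pow_add]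

-- With `m = p - 1 - s`, so that `2 m = n` modulo `p`, the square root `x ^ m r dx` of the quadratic
-- differential is a differential form, and `truncCoeff s r` is its residue.
theorem exists_twist_smul_sq_eq (hn : n + i + 1 = p) (hs : 2 * s + 1 = i ∨ 2 * s + 1 = i + p)
    {y : TruncPoly k p} (hy : x k p ∣ y) (hb : truncCoeff 1 y ≠ 0) (α : k) {r : TruncPoly k p}
    (hr : truncCoeff 0 r = 1) :
    ∃ (α' : k) (r' : TruncPoly k p), truncCoeff 0 r' = 1 ∧
      twist hy (α • (x k p ^ n * r ^ 2)) = α' • (x k p ^ n * r' ^ 2) ∧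
      α' * truncCoeff 1 y ^ i = truncCoeff 1 y * α ∧
      truncCoeff s r' = truncCoeff 1 y ^ s * truncCoeff s r := by
  obtain ⟨m, hm⟩ : ∃ m, p = m + s + 1 := ⟨p - 1 - s, by lia⟩
  obtain ⟨θ, hyθ, hθ⟩ := exists_eq_smul_x_mul (Fact.out : p.Prime).one_lt hy hb
  obtain ⟨d, hd, hd0⟩ : ∃ d, del k p y = truncCoeff 1 y • d ∧ truncCoeff 0 d = 1 :=
    ⟨(truncCoeff 1 y)⁻¹ • del k p y, (smul_inv_smul₀ hb _).symm, by
      rw [map_smul, truncCoeff_zero_del, smul_eq_mul, inv_mul_cancel₀ hb]⟩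
  set b := truncCoeff 1 y
  have hθn : θ ^ n = (θ ^ m) ^ 2 := by
    rw [← pow_mul]
    rcases hs with hs | hs
    · rw [show m * 2 = n + p by lia, pow_add, pow_char_eq, hθ, one_pow, one_smul, mul_one]
    · rw [show m * 2 = n by lia]
  have hyn (j : ℕ) : y ^ j = b ^ j • (x k p ^ j * θ ^ j) := by
    conv_lhs => rw [hyθ, _root_.smul_pow, mul_pow]
  refine ⟨(b ^ p)⁻¹ * b ^ (n + 2) * α, θ ^ m * substHom hy r * d, ?_, ?_, ?_, ?_⟩
  · simp only [truncCoeff_zero_mul, truncCoeff_zero_pow, truncCoeff_zero_substHom, hθ, hr, hd0,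
      one_pow, mul_one]
  · rw [twist_apply, map_smul, map_mul, map_pow, map_pow, substHom_x, hyn, hθn, hd]
    simp only [Algebra.smul_def, map_mul, map_pow]
    ring
  · rw [← hn]
    field_simp
    ring
  · have hform : substHom hy (x k p ^ m * r) * del k p y =
        b ^ (m + 1) • (x k p ^ m * (θ ^ m * substHom hy r * d)) := by
      rw [map_mul, map_pow, substHom_x, hyn, hd]
      simp only [Algebra.smul_def, map_pow]
      ring
    have hres := truncCoeff_pred_substHom_mul_del hy (x k p ^ m * r)
    rw [hform, map_smul, show p - 1 = m + s by lia, truncCoeff_add_x_pow_mul (by lia),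
      truncCoeff_add_x_pow_mul (by lia), smul_eq_mul] at hres
    refine mul_left_cancel₀ (pow_ne_zero (m + 1) hb) (hres.trans ?_)
    rw [← mul_assoc, ← pow_add, add_right_comm m 1 s, ← hm]

end NormalForm

section Classification

variable {k : Type*} [Field k] {p : ℕ} [Fact p.Prime] [CharP k p] {n i s : ℕ}

theorem truncCoeff_eq_of_mem_orbit_normalForm (hp : 3 < p) (hn : n + i + 1 = p)
    (hs : 2 * s + 1 = i ∨ 2 * s + 1 = i + p) (hs0 : 0 < s) {α a : k} (hα : α ≠ 0)
    {r : TruncPoly k p} (hr : truncCoeff 0 r = 1)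
    (h : residueEquiv (α • (x k p ^ n * r ^ 2)) ∈ orbit (residueEquiv (normalForm k p n s a))) :
    ∃ b ≠ 0, α * b ^ i = b ∧ (s ≤ i → truncCoeff s r = b ^ s * (2⁻¹ * a)) := by
  obtain ⟨r₀, hr₀, hrs, hr₀'⟩ := normalForm_eq_smul_sq (p := p) (by lia) hs0 (by lia) n a
  obtain ⟨y, hy, hb, heq⟩ := (mem_orbit_residueEquiv_iff hp).mp h
  obtain ⟨α', r', hr', htwist, hlead, hres⟩ := exists_twist_smul_sq_eq hn hs hy hb 1 hr₀
  rw [hr₀', htwist] at heq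
  obtain ⟨rfl, hcoeff⟩ := smul_sq_inj (by lia) (by lia) hα hr hr' (residueEquiv.injective heq)
  exact ⟨_, hb, hlead.trans (mul_one _), fun hsi => by rw [hcoeff s (by lia), hres, hrs]⟩

theorem HasOrder.exists_normalForm_mem_orbit (hp : 3 < p) (hn : n + i + 1 = p)
    (hs : 2 * s + 1 = i ∨ 2 * s + 1 = i + p) {q : TruncPoly k p} (hq : HasOrder n q) {b : k}
    (hb : b ≠ 0) (h : truncCoeff n q * b ^ i = b) :
    ∃ a, residueEquiv (normalForm k p n s a) ∈ orbit (residueEquiv q) := by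
  obtain ⟨β, hβ⟩ := exists_mem_orbit_add (s := s) hp
    (fun m _ hm hms => natCast_ne_zero_of_ne (by lia) hn hs hm hms) hq
  refine ⟨_, mem_orbit_trans hβ
    (normalForm_mem_orbit_smul_add hp hn (c := b⁻¹) (inv_ne_zero hb) ?_)⟩
  rw [inv_pow, inv_eq_iff_eq_inv, mul_inv, inv_inv, eq_mul_inv_iff_mul_eq₀ hq.2, mul_comm, h]

theorem smul_sq_mem_orbit_normalForm_iff (hp : 3 < p) (hn : n + i + 1 = p)
    (hs : 2 * s + 1 = i ∨ 2 * s + 1 = i + p) (hs0 : 0 < s) {α a : k} (hα : α ≠ 0)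
    {r : TruncPoly k p} (hr : truncCoeff 0 r = 1) :
    residueEquiv (α • (x k p ^ n * r ^ 2)) ∈ orbit (residueEquiv (normalForm k p n s a)) ↔
      ∃ b ≠ 0, α * b ^ i = b ∧ (s ≤ i → truncCoeff s r = b ^ s * (2⁻¹ * a)) := by
  refine ⟨truncCoeff_eq_of_mem_orbit_normalForm hp hn hs hs0 hα hr, ?_⟩
  rintro ⟨b, hb, hbi, hbs⟩
  obtain ⟨a₁, ha₁⟩ := (hasOrder_smul_sq (by lia) hα hr).exists_normalForm_mem_orbit hp hn hs hb
    (by rwa [truncCoeff_smul_sq (by lia) α hr])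
  have hmem := mem_orbit_symm ha₁
  obtain ⟨b₁, hb₁, hbi₁, hbs₁⟩ := truncCoeff_eq_of_mem_orbit_normalForm hp hn hs hs0 hα hr hmem
  refine mem_orbit_trans ?_ hmem
  have hc : (b / b₁) ^ i = b / b₁ * 1 := by
    rw [mul_one, div_pow, div_eq_div_iff (pow_ne_zero _ hb₁) hb₁]
    apply mul_left_cancel₀ hα
    linear_combination b₁ * hbi - b * hbi₁
  have hscale := normalForm_mem_orbit_smul_add (s := s) (β := a) hp hn (div_ne_zero hb hb₁) hc
  rw [one_smul, inv_one, mul_one] at hscale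
  rcases le_or_gt s i with hsi | hsi
  · have h2 : (2 : k) ≠ 0 := two_ne_zero_of_char_ne (p := p) (by lia)
    have heq := (hbs hsi).symm.trans (hbs₁ hsi)
    have : a * (b / b₁) ^ s = a₁ := by
      rw [div_pow, mul_div_assoc', div_eq_iff (pow_ne_zero s hb₁)]
      apply mul_left_cancel₀ (inv_ne_zero h2)
      linear_combination heq
    rwa [this] at hscale
  · rw [normalForm, normalForm, x_pow_eq_zero (n := n + s) (by lia), smul_zero, smul_zero]
    exact mem_orbit_self _

-- Substitutions preserve a leading coefficient in degree `p - 2`, as `c ^ (p - 2 + 2) = c ^ p`.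
theorem mem_orbit_smul_x_pow_iff (hp : 3 < p) {α : k} (hα : α ≠ 0) {q : TruncPoly k p} :
    residueEquiv q ∈ orbit (residueEquiv (α • x k p ^ (p - 2))) ↔
      x k p ^ (p - 2) ∣ q ∧ truncCoeff (p - 2) q = α := by
  have hlead {q r : TruncPoly k p} (hq : x k p ^ (p - 2) ∣ q)
      (h : residueEquiv r ∈ orbit (residueEquiv q)) :
      x k p ^ (p - 2) ∣ r ∧ truncCoeff (p - 2) r = truncCoeff (p - 2) q := by
    obtain ⟨y, hy, hb, heq⟩ := (mem_orbit_residueEquiv_iff hp).mp h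
    rw [residueEquiv.injective heq]
    refine ⟨x_pow_dvd_twist hy hq, ?_⟩
    rw [truncCoeff_twist hy (by lia) hq, show p - 2 + 2 = p by lia,
      inv_mul_cancel₀ (pow_ne_zero p hb), one_mul]
  have hcoeff (β : k) : truncCoeff (p - 2) (β • x k p ^ (p - 2)) = β := by
    rw [map_smul, truncCoeff_x_pow (by lia), if_pos rfl, smul_eq_mul, mul_one]
  constructor
  · intro h
    have := hlead (dvd_smul_of_dvd α dvd_rfl) h
    rwa [hcoeff] at this
  · rintro ⟨hq, rfl⟩
    obtain ⟨β, hβ⟩ := exists_mem_orbit_add (s := 0) hp (fun m _ hm hms =>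
      natCast_ne_zero_of_ne (i := 1) (by lia) (by lia) (.inl rfl) hm hms) ⟨hq, hα⟩
    rw [add_zero, ← add_smul] at hβ
    have := (hlead hq hβ).2
    rw [hcoeff] at this
    rw [this] at hβ
    exact mem_orbit_symm hβ

end Classification

section SepClosed

theorem infinite_of_isSepClosed (k : Type*) [Field k] [IsSepClosed k] : Infinite k := by
  by_contra h
  rw [not_infinite_iff_finite] at h
  have := Fintype.ofFinite k
  have hder : derivative (X ^ Fintype.card k - X - 1 : k[X]) = -1 := by
    simp [derivative_X_pow]
  have hsep : (X ^ Fintype.card k - X - 1 : k[X]).Separable := by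
    rw [Polynomial.Separable, hder]
    exact isCoprime_one_right.neg_right
  have hdeg : (X ^ Fintype.card k - X - 1 : k[X]).natDegree = Fintype.card k := by
    rw [← C_1, natDegree_sub_C, FiniteField.X_pow_card_sub_X_natDegree_eq k Fintype.one_lt_card]
  obtain ⟨z, hz⟩ := IsSepClosed.exists_root _
    (degree_ne_of_natDegree_ne (hdeg.trans_ne Fintype.card_ne_zero)) hsep
  simp [FiniteField.pow_card] at hz

variable {k : Type*} [Field k] [IsSepClosed k] {p i : ℕ} [CharP k p]

theorem exists_mul_pow_eq_self (hip : i < p) (hi : i ≠ 1) {c : k} (hc : c ≠ 0) :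
    ∃ b ≠ 0, c * b ^ i = b := by
  rcases Nat.eq_zero_or_pos i with rfl | hpos
  · exact ⟨c, hc, by simp⟩
  have : NeZero ((i - 1 : ℕ) : k) := ⟨natCast_ne_zero_of_lt (p := p) (by lia) (by lia)⟩
  obtain ⟨b, hb⟩ := IsSepClosed.exists_pow_nat_eq c⁻¹ (i - 1)
  have hb0 : b ≠ 0 := by
    rintro rfl
    rw [zero_pow (by lia)] at hb
    exact inv_ne_zero hc hb.symm
  refine ⟨b, hb0, ?_⟩
  rw [show i = i - 1 + 1 by lia, pow_succ, hb, mul_inv_cancel_left₀ hc]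

end SepClosed

section ZariskiTopology

attribute [local instance] zariski

variable {k : Type*} [Field k] {ι κ : Type*}

theorem isClosed_iff_exists_zeros {Z : Set (ι → k)} :
    IsClosed Z ↔ ∃ S : Set (MvPolynomial ι k), Z = zeros k S := by
  rw [← isOpen_compl_iff]
  change Zᶜᶜ ∈ {Z | ∃ S : Set (MvPolynomial ι k), Z = zeros k S} ↔ _
  rw [compl_compl, Set.mem_ofPred_eq]

theorem isClosed_zeros (S : Set (MvPolynomial ι k)) : IsClosed (zeros k S) :=
  isClosed_iff_exists_zeros.mpr ⟨S, rfl⟩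

theorem mem_zeros_singleton {f : MvPolynomial ι k} {v : ι → k} :
    v ∈ zeros k {f} ↔ MvPolynomial.eval v f = 0 := by
  simp [zeros]

section KrullDim

theorem isPrime_vanishingIdeal {Z : Set (ι → k)} (hZ : IsIrreducible Z) :
    (MvPolynomial.vanishingIdeal k Z).IsPrime := by
  rw [Ideal.isPrime_iff]
  refine ⟨fun h => ?_, fun {f g} hfg => ?_⟩
  · obtain ⟨v, hv⟩ := hZ.nonempty
    exact one_ne_zero ((map_one (MvPolynomial.aeval v)).symm.trans
      (MvPolynomial.mem_vanishingIdeal_iff.mp (h ▸ Submodule.mem_top) v hv))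
  · have hsub : Z ⊆ zeros k {f} ∪ zeros k {g} := fun v hv => by
      simpa [mem_zeros_singleton, MvPolynomial.aeval_eq_eval] using
        MvPolynomial.mem_vanishingIdeal_iff.mp hfg v hv
    refine (isPreirreducible_iff_isClosed_union_isClosed.mp hZ.isPreirreducible _ _
      (isClosed_zeros {f}) (isClosed_zeros {g}) hsub).imp ?_ ?_ <;>
    exact fun h => MvPolynomial.mem_vanishingIdeal_iff.mpr fun v hv => by
      simpa [MvPolynomial.aeval_eq_eval] using mem_zeros_singleton.mp (h hv)

theorem subset_of_vanishingIdeal_le {Y Z : Set (ι → k)} (hZ : IsClosed Z)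
    (h : MvPolynomial.vanishingIdeal k Z ≤ MvPolynomial.vanishingIdeal k Y) : Y ⊆ Z := by
  obtain ⟨S, rfl⟩ := isClosed_iff_exists_zeros.mp hZ
  intro v hv f hf
  have hmem : f ∈ MvPolynomial.vanishingIdeal k (zeros k S) :=
    MvPolynomial.mem_vanishingIdeal_iff.mpr fun w hw => by
      simpa [MvPolynomial.aeval_eq_eval] using hw f hf
  simpa [MvPolynomial.aeval_eq_eval] using MvPolynomial.mem_vanishingIdeal_iff.mp (h hmem) v hv

theorem topologicalKrullDim_pi_le [Finite ι] :
    topologicalKrullDim (ι → k) ≤ (Nat.card ι : WithBot ℕ∞) := by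
  have hmono : topologicalKrullDim (ι → k) ≤
      Order.krullDim (PrimeSpectrum (MvPolynomial ι k))ᵒᵈ := by
    refine Order.krullDim_le_of_strictMono (fun Z : TopologicalSpace.IrreducibleCloseds (ι → k) =>
      OrderDual.toDual (⟨_, isPrime_vanishingIdeal Z.isIrreducible⟩ : PrimeSpectrum _)) ?_
    intro Y Z hYZ
    rw [OrderDual.toDual_lt_toDual, lt_iff_le_not_ge]
    exact ⟨MvPolynomial.vanishingIdeal_anti_mono hYZ.le,
      fun h => hYZ.not_ge (subset_of_vanishingIdeal_le Y.isClosed h)⟩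
  have hpoly := MvPolynomial.ringKrullDim_of_isNoetherianRing (R := k) (ι := ι)
  rw [ringKrullDim_eq_zero_of_field, zero_add] at hpoly
  rw [Order.krullDim_orderDual] at hmono
  exact hmono.trans_eq hpoly

end KrullDim

section Regular

/-- A function that is regular on the subset `S` of an affine space: on `S` it is the quotient of
two polynomials whose denominator has no zero in `S`. -/
def IsRegularOn (S : Set (ι → k)) (g : (ι → k) → k) : Prop :=
  ∃ P Q : MvPolynomial ι k, ∀ v ∈ S, MvPolynomial.eval v Q ≠ 0 ∧
    g v * MvPolynomial.eval v Q = MvPolynomial.eval v P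

namespace IsRegularOn

variable {S : Set (ι → k)} {g h : (ι → k) → k}

theorem const (c : k) : IsRegularOn S fun _ => c :=
  ⟨MvPolynomial.C c, 1, fun v _ => by simp⟩

theorem coord (j : ι) : IsRegularOn S fun v => v j :=
  ⟨MvPolynomial.X j, 1, fun v _ => by simp⟩

theorem add (hg : IsRegularOn S g) (hh : IsRegularOn S h) : IsRegularOn S fun v => g v + h v := by
  obtain ⟨P, Q, hPQ⟩ := hg
  obtain ⟨R, T, hRT⟩ := hh
  refine ⟨P * T + R * Q, Q * T, fun v hv => ?_⟩
  obtain ⟨hQ, hP⟩ := hPQ v hv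
  obtain ⟨hT, hR⟩ := hRT v hv
  simp only [map_mul, map_add, ← hP, ← hR]
  exact ⟨mul_ne_zero hQ hT, by ring⟩

theorem mul (hg : IsRegularOn S g) (hh : IsRegularOn S h) : IsRegularOn S fun v => g v * h v := by
  obtain ⟨P, Q, hPQ⟩ := hg
  obtain ⟨R, T, hRT⟩ := hh
  refine ⟨P * R, Q * T, fun v hv => ?_⟩
  obtain ⟨hQ, hP⟩ := hPQ v hv
  obtain ⟨hT, hR⟩ := hRT v hv
  simp only [map_mul, ← hP, ← hR]
  exact ⟨mul_ne_zero hQ hT, by ring⟩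

theorem inv (hg : IsRegularOn S g) (h0 : ∀ v ∈ S, g v ≠ 0) : IsRegularOn S fun v => (g v)⁻¹ := by
  obtain ⟨P, Q, hPQ⟩ := hg
  refine ⟨Q, P, fun v hv => ?_⟩
  obtain ⟨hQ, hP⟩ := hPQ v hv
  rw [← hP]
  exact ⟨mul_ne_zero (h0 v hv) hQ, inv_mul_cancel_left₀ (h0 v hv) _⟩

theorem pow (hg : IsRegularOn S g) (n : ℕ) : IsRegularOn S fun v => g v ^ n := by
  induction n with
  | zero => simpa using const 1
  | succ n ih => simpa only [pow_succ] using ih.mul hg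

theorem sum {α : Type*} (s : Finset α) {g : α → (ι → k) → k} (hg : ∀ a ∈ s, IsRegularOn S (g a)) :
    IsRegularOn S fun v => ∑ a ∈ s, g a v := by
  classical
  induction s using Finset.induction_on with
  | empty => simpa using const 0
  | insert a s ha ih =>
    simp only [Finset.sum_insert ha]
    exact (hg a (Finset.mem_insert_self a s)).add
      (ih fun b hb => hg b (Finset.mem_insert_of_mem hb))

theorem eval {F : (ι → k) → κ → k} (hF : ∀ j, IsRegularOn S fun v => F v j)
    (f : MvPolynomial κ k) : IsRegularOn S fun v => MvPolynomial.eval (F v) f := by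
  induction f using MvPolynomial.induction_on with
  | C a => simpa using const a
  | add f g hf hg => simpa using hf.add hg
  | mul_X f j hf => simpa using hf.mul (hF j)

theorem continuousOn {F : (ι → k) → κ → k} (hF : ∀ j, IsRegularOn S fun v => F v j) :
    ContinuousOn F S := by
  rw [continuousOn_iff_isClosed]
  intro Z hZ
  obtain ⟨T, rfl⟩ := isClosed_iff_exists_zeros.mp hZ
  choose P Q hPQ using eval hF
  refine ⟨zeros k (P '' T), isClosed_zeros _, ?_⟩
  ext v
  refine and_congr_left fun hv => ?_
  simp only [zeros, Set.mem_preimage, Set.mem_ofPred_eq, Set.forall_mem_image]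
  refine forall₂_congr fun f _ => ?_
  obtain ⟨hQ, hP⟩ := hPQ f v hv
  rw [← hP, mul_eq_zero, or_iff_left hQ]

end IsRegularOn

theorem topologicalKrullDim_eq_of_isRegularOn {S : Set (ι → k)} {T : Set (κ → k)}
    {F : (ι → k) → κ → k} {G : (κ → k) → ι → k} (hST : Set.MapsTo F S T) (hTS : Set.MapsTo G T S)
    (hGF : Set.LeftInvOn G F S) (hFG : Set.LeftInvOn F G T)
    (hF : ∀ j, IsRegularOn S fun v => F v j) (hG : ∀ j, IsRegularOn T fun u => G u j) :
    topologicalKrullDim S = topologicalKrullDim T :=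
  let Φ : S ≃ₜ T :=
    { toFun := hST.restrict F S T
      invFun := hTS.restrict G T S
      left_inv v := Subtype.ext (hGF v.2)
      right_inv u := Subtype.ext (hFG u.2)
      continuous_toFun := (IsRegularOn.continuousOn hF).mapsToRestrict hST
      continuous_invFun := (IsRegularOn.continuousOn hG).mapsToRestrict hTS }
  IsHomeomorph.topologicalKrullDim_eq Φ Φ.isHomeomorph

theorem topologicalKrullDim_graph {t : ι} {S : Set ({j // j ≠ t} → k)}
    {f : ({j // j ≠ t} → k) → k} (hf : IsRegularOn S f) :
    topologicalKrullDim {v : ι → k | (fun j : {j // j ≠ t} => v j) ∈ S ∧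
      v t = f fun j => v j} = topologicalKrullDim S := by
  classical
  let lift (w : {j // j ≠ t} → k) (j : ι) : k := if h : j = t then f w else w ⟨j, h⟩
  have lift_coe (w : {j // j ≠ t} → k) : (fun j : {j // j ≠ t} => lift w j) = w :=
    funext fun j => dif_neg j.2
  refine topologicalKrullDim_eq_of_isRegularOn (F := fun v j => v j) (G := lift)
    (fun v hv => hv.1) (fun w hw => ?_) (fun v hv => ?_) (fun w _ => lift_coe w)
    (fun j => .coord _) (fun j => ?_)
  · rw [Set.mem_ofPred_eq, lift_coe]
    exact ⟨hw, dif_pos rfl⟩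
  · funext j
    by_cases h : j = t
    · simp only [lift, h, dif_pos, hv.2]
    · simp only [lift, h, dif_neg, not_false_eq_true]
  · by_cases h : j = t
    · simpa only [lift, h, dif_pos] using hf
    · simpa only [lift, h, dif_neg, not_false_eq_true] using IsRegularOn.coord _

end Regular

section NonzeroSet

variable (k) in
/-- The complement in affine space of the coordinate hyperplanes with indices in `J`. -/
def nonzeroSet (J : Set ι) : Set (ι → k) := {v | ∀ j ∈ J, v j ≠ 0}

theorem isOpen_nonzeroSet [Finite ι] (J : Set ι) : IsOpen (nonzeroSet k J) := by
  have : nonzeroSet k J = ⋂ j : J, (zeros k {MvPolynomial.X (j : ι)})ᶜ := by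
    ext v
    simp [nonzeroSet, zeros]
  rw [this]
  exact isOpen_iInter_of_finite fun j => (isClosed_zeros _).isOpen_compl

open Classical in
/-- The retraction of affine space onto the linear subspace on which the coordinates with indices
in `I` are equal to `1`. -/
def fixOne (I : Set ι) (v : ι → k) : ι → k := fun j => if j ∈ I then 1 else v j

theorem fixOne_eq_self_iff {I : Set ι} {v : ι → k} : fixOne I v = v ↔ ∀ j ∈ I, v j = 1 := by
  refine funext_iff.trans (forall_congr' fun j => ?_)
  by_cases h : j ∈ I
  · simp [fixOne, h, eq_comm]
  · simp [fixOne, h]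

theorem mapsTo_fixOne (I J : Set ι) :
    Set.MapsTo (fixOne I) (nonzeroSet k J) (nonzeroSet k J) := by
  intro v hv j hj
  by_cases h : j ∈ I
  · simp only [fixOne, h, if_true, ne_eq, one_ne_zero, not_false_eq_true]
  · simpa only [fixOne, h, if_false] using hv j hj

theorem continuousOn_fixOne (I : Set ι) (S : Set (ι → k)) : ContinuousOn (fixOne I) S := by
  refine IsRegularOn.continuousOn fun j => ?_
  by_cases h : j ∈ I
  · simpa only [fixOne, h, if_true] using IsRegularOn.const 1
  · simpa only [fixOne, h, if_false] using IsRegularOn.coord j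

variable [Infinite k]

theorem isIrreducible_univ_pi : IsIrreducible (Set.univ : Set (ι → k)) := by
  refine ⟨⟨0, trivial⟩, isPreirreducible_iff_isClosed_union_isClosed.mpr fun Y Z hY hZ h => ?_⟩
  obtain ⟨S, rfl⟩ := isClosed_iff_exists_zeros.mp hY
  obtain ⟨T, rfl⟩ := isClosed_iff_exists_zeros.mp hZ
  by_contra! hc
  obtain ⟨⟨v, -, hv⟩, w, -, hw⟩ := hc.imp Set.not_subset.mp Set.not_subset.mp
  simp only [zeros, Set.mem_ofPred_eq, not_forall] at hv hw
  obtain ⟨f, hf, hfv⟩ := hv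
  obtain ⟨g, hg, hgw⟩ := hw
  have hfg : f * g = 0 := MvPolynomial.funext fun u => by
    rw [map_mul, map_zero, mul_eq_zero]
    exact (h (Set.mem_univ u)).imp (· f hf) (· g hg)
  rcases mul_eq_zero.mp hfg with rfl | rfl
  · exact hfv (map_zero _)
  · exact hgw (map_zero _)

theorem isIrreducible_nonzeroSet [Finite ι] (J : Set ι) : IsIrreducible (nonzeroSet k J) :=
  ⟨⟨1, fun _ _ => one_ne_zero⟩,
    isIrreducible_univ_pi.isPreirreducible.open_subset (isOpen_nonzeroSet J) (Set.subset_univ _)⟩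

variable (k) in
/-- The part of `nonzeroSet k J` on which the coordinates with indices in `I` are equal to `1`, as
an irreducible closed subset. Decreasing `I` gives chains of such subsets. -/
def eqOneSet [Finite ι] (I J : Set ι) :
    TopologicalSpace.IrreducibleCloseds (nonzeroSet k J) where
  carrier := {v | ∀ j ∈ I, (v : ι → k) j = 1}
  isIrreducible' := by
    have := Subtype.irreducibleSpace (isIrreducible_nonzeroSet (k := k) J)
    have himage := (IrreducibleSpace.isIrreducible_univ (nonzeroSet k J)).image _
      ((continuousOn_fixOne I _).mapsToRestrict (mapsTo_fixOne I J)).continuousOn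
    convert himage using 1
    ext v
    simp only [Set.image_univ, Set.mem_range, Set.mem_ofPred_eq]
    constructor
    · exact fun h => ⟨v, Subtype.ext (fixOne_eq_self_iff.mpr h)⟩
    · rintro ⟨w, rfl⟩ j hj
      exact if_pos hj
  isClosed' := by
    have : {v : ι → k | ∀ j ∈ I, v j = 1} = zeros k ((fun j => MvPolynomial.X j - 1) '' I) := by
      ext v
      simp [zeros, sub_eq_zero]
    exact (this ▸ isClosed_zeros _ : IsClosed {v : ι → k | ∀ j ∈ I, v j = 1}).preimage
      continuous_subtype_val

theorem eqOneSet_lt_eqOneSet [Finite ι] {I I' : Set ι} (h : I ⊂ I') (J : Set ι) :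
    eqOneSet k I' J < eqOneSet k I J := by
  classical
  obtain ⟨hsub, j, hj, hjI⟩ := Set.ssubset_iff_exists.mp h
  obtain ⟨c, hc⟩ := Infinite.exists_notMem_finset ({0, 1} : Finset k)
  simp only [Finset.mem_insert, Finset.mem_singleton, not_or] at hc
  refine lt_of_le_not_ge (fun v hv i hi => hv i (hsub hi)) fun hle => hc.2 ?_
  have hw : Function.update (1 : ι → k) j c ∈ nonzeroSet k J := by
    intro i _
    rcases eq_or_ne i j with rfl | hij
    · simpa using hc.1
    · simp [hij]
  have hmem : (⟨_, hw⟩ : nonzeroSet k J) ∈ eqOneSet k I J := fun i hi => by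
    simp [ne_of_mem_of_not_mem hi hjI]
  simpa using hle hmem j hj

theorem topologicalKrullDim_nonzeroSet [Finite ι] (J : Set ι) :
    topologicalKrullDim (nonzeroSet k J) = (Nat.card ι : WithBot ℕ∞) := by
  refine le_antisymm ((topologicalKrullDim_subspace_le _ _).trans topologicalKrullDim_pi_le) ?_
  let ε : ι ≃ Fin (Nat.card ι) := Finite.equivFin ι
  have hflag : StrictMono fun l : Fin (Nat.card ι + 1) =>
      eqOneSet k {j | (l : ℕ) ≤ (ε j : ℕ)} J := by
    refine Fin.strictMono_iff_lt_succ.mpr fun l => eqOneSet_lt_eqOneSet ?_ J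
    refine Set.ssubset_iff_exists.mpr ⟨fun j hj => ?_, ε.symm l, ?_, ?_⟩
    · simp only [Fin.val_succ, Fin.val_castSucc, Set.mem_ofPred_eq] at hj ⊢
      lia
    · simp
    · simp
  exact Order.LTSeries.length_le_krullDim (LTSeries.mk (Nat.card ι) _ hflag)

end NonzeroSet

end ZariskiTopology

section Parametrization

attribute [local instance] zariski

variable {k : Type*} [Field k] {p : ℕ}

theorem dim_eq_topologicalKrullDim [CharP k p] (O : Set (Module.Dual k (W k p))) :
    dim O = topologicalKrullDim {u : Fin p → k | residueEquiv (ofCoords u) ∈ O} := by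
  have hleft (χ : Module.Dual k (W k p)) : residueEquiv (ofCoords (coords χ)) = χ :=
    residueEquiv.apply_symm_apply χ
  have hright (u : Fin p → k) : coords (residueEquiv (ofCoords u)) = u :=
    funext fun m => by rw [coords_residueEquiv, truncCoeff_ofCoords, Fin.rev_rev]
  let _ : TopologicalSpace O := .induced (fun χ : O => coords (χ : Module.Dual k (W k p)))
    (zariski k (Fin p))
  let Φ : O ≃ {u : Fin p → k | residueEquiv (ofCoords u) ∈ O} :=
    { toFun χ := ⟨coords χ.1, by rw [Set.mem_ofPred_eq, hleft]; exact χ.2⟩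
      invFun u := ⟨residueEquiv (ofCoords u.1), u.2⟩
      left_inv χ := Subtype.ext (hleft χ.1)
      right_inv u := Subtype.ext (hright u.1) }
  have hΦ : Topology.IsInducing Φ := Topology.IsInducing.subtypeVal.of_comp_iff.mp ⟨rfl⟩
  exact IsHomeomorph.topologicalKrullDim_eq Φ (Φ.toHomeomorphOfIsInducing hΦ).isHomeomorph

/-- A family of truncated polynomials whose coefficients are regular functions on `S`. -/
def IsRegularFamily {ι : Type*} (S : Set (ι → k)) (a : (ι → k) → TruncPoly k p) : Prop :=
  ∀ m, IsRegularOn S fun v => truncCoeff m (a v)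

namespace IsRegularFamily

variable {ι : Type*} {S : Set (ι → k)} {a b : (ι → k) → TruncPoly k p}

theorem const (c : TruncPoly k p) : IsRegularFamily S fun _ => c := fun _ => .const _

theorem smul {c : (ι → k) → k} (hc : IsRegularOn S c) (ha : IsRegularFamily S a) :
    IsRegularFamily S fun v => c v • a v := fun m => by
  simpa only [map_smul, smul_eq_mul] using hc.mul (ha m)

theorem sum {α : Type*} (s : Finset α) {a : α → (ι → k) → TruncPoly k p}
    (ha : ∀ j ∈ s, IsRegularFamily S (a j)) : IsRegularFamily S fun v => ∑ j ∈ s, a j v :=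
  fun m => by simpa only [map_sum] using IsRegularOn.sum s fun j hj => ha j hj m

theorem mul (ha : IsRegularFamily S a) (hb : IsRegularFamily S b) :
    IsRegularFamily S fun v => a v * b v := by
  have hab (v : ι → k) : a v * b v = ∑ j ∈ Finset.range p, ∑ l ∈ Finset.range p,
      truncCoeff j (a v) • truncCoeff l (b v) • (x k p ^ j * x k p ^ l) := by
    conv_lhs => rw [eq_sum_truncCoeff_smul (a v), eq_sum_truncCoeff_smul (b v)]
    simp only [Finset.sum_mul_sum, smul_mul_smul_comm, smul_smul]
  simp only [hab]
  exact sum _ fun j _ => sum _ fun l _ => smul (ha j) (smul (hb l) (const _))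

theorem pow (ha : IsRegularFamily S a) (n : ℕ) : IsRegularFamily S fun v => a v ^ n := by
  induction n with
  | zero => simpa only [pow_zero] using const 1
  | succ n ih => simpa only [pow_succ] using ih.mul ha

theorem ofCoords {S : Set (Fin p → k)} : IsRegularFamily S ofCoords :=
  sum _ fun _ _ => smul (.coord _) (const _)

theorem sqrtUnit {n : ℕ} (ha : IsRegularFamily S a) (hS : ∀ v ∈ S, truncCoeff n (a v) ≠ 0) :
    IsRegularFamily S fun v => sqrtUnit n (a v) :=
  (smul ((ha n).inv hS) (sum _ fun _ _ => smul (ha _) (const _))).pow _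

end IsRegularFamily

/-- The truncated polynomial with constant term `1` and homogeneous coordinates `v`. -/
def unitOfCoords {i : ℕ} (p : ℕ) (v : Fin (i + 1) → k) : TruncPoly k p :=
  (v 0)⁻¹ • ∑ j, v j • x k p ^ (j : ℕ)

variable {n i : ℕ}

theorem truncCoeff_unitOfCoords (hi : i < p) (v : Fin (i + 1) → k) (j : Fin (i + 1)) :
    truncCoeff j (unitOfCoords p v) = (v 0)⁻¹ * v j := by
  simp only [unitOfCoords, map_smul, map_sum, smul_eq_mul]
  congr 1
  rw [Finset.sum_eq_single j (fun l _ hl => ?_) (by simp), truncCoeff_x_pow (by lia), if_pos rfl,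
    mul_one]
  rw [truncCoeff_x_pow (by lia), if_neg (Fin.val_ne_of_ne hl.symm), mul_zero]

theorem truncCoeff_zero_unitOfCoords (hi : i < p) {v : Fin (i + 1) → k} (hv : v 0 ≠ 0) :
    truncCoeff 0 (unitOfCoords p v) = 1 :=
  (truncCoeff_unitOfCoords hi v 0).trans (inv_mul_cancel₀ hv)

theorem x_pow_mul_unitOfCoords (hn : n + i + 1 = p) {α : k} (hα : α ≠ 0) {r : TruncPoly k p}
    (hr : truncCoeff 0 r = 1) :
    x k p ^ n * unitOfCoords p (fun j : Fin (i + 1) => α * truncCoeff j r) = x k p ^ n * r := by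
  refine ext_truncCoeff fun m hm => ?_
  rcases lt_or_ge m n with hmn | hmn
  · rw [truncCoeff_x_pow_mul_of_lt hmn hm, truncCoeff_x_pow_mul_of_lt hmn hm]
  · obtain ⟨j, rfl⟩ := Nat.exists_eq_add_of_le hmn
    rw [truncCoeff_add_x_pow_mul hm, truncCoeff_add_x_pow_mul hm]
    refine (truncCoeff_unitOfCoords (by lia) _ ⟨j, by lia⟩).trans ?_
    simp [hr, hα]

/-- The truncated polynomial of order `n` whose coefficient of `x ^ n` is `v 0` and whose
normalized square root is given by the homogeneous coordinates `v`. -/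
def ofSqrtCoords (p n : ℕ) (v : Fin (i + 1) → k) : TruncPoly k p :=
  v 0 • (x k p ^ n * unitOfCoords p v ^ 2)

/-- The coordinates inverse to `ofSqrtCoords`: the coefficients of the normalized square root of
`q`, multiplied by the coefficient of `x ^ n` in `q`. -/
def sqrtCoords (n i : ℕ) (q : TruncPoly k p) (j : Fin (i + 1)) : k :=
  truncCoeff n q * truncCoeff j (sqrtUnit n q)

theorem IsRegularFamily.ofSqrtCoords {S : Set (Fin (i + 1) → k)} (hS : ∀ v ∈ S, v 0 ≠ 0) (n : ℕ) :
    IsRegularFamily S (ofSqrtCoords p n) :=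
  smul (.coord 0) (mul (const _)
    (pow (smul (.inv (.coord 0) hS) (sum _ fun j _ => smul (.coord j) (const _))) 2))

variable [Fact p.Prime] [CharP k p]

theorem sqrtCoords_zero (hp : p ≠ 2) {q : TruncPoly k p} (hq : HasOrder n q) :
    sqrtCoords n i q 0 = truncCoeff n q :=
  (congrArg (truncCoeff n q * ·) (hq.sqrtUnit_spec hp).1).trans (mul_one _)

theorem ofSqrtCoords_sqrtCoords (hp : p ≠ 2) (hn : n + i + 1 = p) {q : TruncPoly k p}
    (hq : HasOrder n q) : ofSqrtCoords p n (sqrtCoords n i q) = q := by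
  obtain ⟨hr, hrq⟩ := hq.sqrtUnit_spec hp
  have hx : x k p ^ n * unitOfCoords p (sqrtCoords n i q) = x k p ^ n * sqrtUnit n q :=
    x_pow_mul_unitOfCoords hn hq.2 hr
  have hsq : x k p ^ n * unitOfCoords p (sqrtCoords n i q) ^ 2 = x k p ^ n * sqrtUnit n q ^ 2 := by
    linear_combination (unitOfCoords p (sqrtCoords n i q) + sqrtUnit n q) * hx
  rw [ofSqrtCoords, sqrtCoords_zero hp hq, hsq, hrq]

theorem sqrtCoords_ofSqrtCoords (hp : p ≠ 2) (hn : n + i + 1 = p) {v : Fin (i + 1) → k}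
    (hv : v 0 ≠ 0) : sqrtCoords n i (ofSqrtCoords p n v) = v := by
  have hr := truncCoeff_zero_unitOfCoords (p := p) (by lia) hv
  have hq : HasOrder n (ofSqrtCoords p n v) := hasOrder_smul_sq (by lia) hv hr
  obtain ⟨hr', hrq⟩ := hq.sqrtUnit_spec hp
  obtain ⟨hlead, hcoeff⟩ := smul_sq_inj hp (by lia) hq.2 hr' hr hrq
  funext j
  rw [sqrtCoords, hlead, hcoeff j (by lia), truncCoeff_unitOfCoords (by lia),
    mul_inv_cancel_left₀ hv]

theorem dim_eq_topologicalKrullDim_ofSqrtCoords (hp : p ≠ 2) (hn : n + i + 1 = p)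
    {O : Set (Module.Dual k (W k p))} (hO : ∀ q, residueEquiv q ∈ O → HasOrder n q) :
    dim O = topologicalKrullDim
      {v : Fin (i + 1) → k | v 0 ≠ 0 ∧ residueEquiv (ofSqrtCoords p n v) ∈ O} := by
  let F (u : Fin p → k) : Fin (i + 1) → k := sqrtCoords n i (ofCoords u)
  let G (v : Fin (i + 1) → k) : Fin p → k := coords (residueEquiv (ofSqrtCoords p n v))
  have hG (v : Fin (i + 1) → k) : ofCoords (G v) = ofSqrtCoords p n v :=
    residueEquiv.symm_apply_apply _
  have hGF {u : Fin p → k} (hu : HasOrder n (ofCoords u)) :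
      ofSqrtCoords p n (F u) = ofCoords u := ofSqrtCoords_sqrtCoords hp hn hu
  rw [dim_eq_topologicalKrullDim]
  refine topologicalKrullDim_eq_of_isRegularOn (F := F) (G := G) (fun u hu => ?_) (fun v hv => ?_)
    (fun u hu => ?_) (fun v hv => ?_) (fun j => ?_) (fun m => ?_)
  · refine ⟨(sqrtCoords_zero hp (hO _ hu)).trans_ne (hO _ hu).2, ?_⟩
    rwa [hGF (hO _ hu)]
  · rw [Set.mem_ofPred_eq, hG]
    exact hv.2
  · funext m
    simp only [G]
    rw [hGF (hO _ hu), coords_residueEquiv, truncCoeff_ofCoords, Fin.rev_rev]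
  · simp only [F, hG]
    exact sqrtCoords_ofSqrtCoords hp hn hv.1
  · exact (IsRegularFamily.ofCoords n).mul
      (IsRegularFamily.ofCoords.sqrtUnit (fun u hu => (hO _ hu).2) j)
  · simp only [G, coords_residueEquiv]
    exact IsRegularFamily.ofSqrtCoords (fun v hv => hv.1) n m.rev

end Parametrization

section OrbitDimension

attribute [local instance] zariski

variable {k : Type*} [Field k] {p : ℕ} [Fact p.Prime] [CharP k p] {n i s : ℕ}

theorem natCard_fin_ne (t : Fin (i + 1)) : Nat.card {j : Fin (i + 1) // j ≠ t} = i := by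
  simp [Nat.card_eq_fintype_card, Fintype.card_subtype_compl]

theorem topologicalKrullDim_ne_zero_and_eq [Infinite k] {t u : Fin (i + 1)} (hut : u ≠ t)
    {f : ({j // j ≠ t} → k) → k} (hf : IsRegularOn (nonzeroSet k {⟨u, hut⟩}) f) :
    topologicalKrullDim {v : Fin (i + 1) → k | v u ≠ 0 ∧ v t = f fun j => v j} = i := by
  have hdim := topologicalKrullDim_graph hf
  rw [topologicalKrullDim_nonzeroSet, natCard_fin_ne] at hdim
  refine Eq.trans (congrArg (fun S : Set _ => topologicalKrullDim S) (Set.ext fun v => ?_)) hdim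
  simp only [nonzeroSet, Set.mem_singleton_iff, forall_eq, Set.mem_ofPred_eq]

theorem hasOrder_of_mem_orbit (hp : 3 < p) {q q' : TruncPoly k p} (hq : HasOrder n q)
    (h : residueEquiv q' ∈ orbit (residueEquiv q)) : HasOrder n q' := by
  have hn := hq.lt
  rw [← height_residueEquiv_eq_iff (i := (p : ℤ) - 1 - n) (by lia) (by lia),
    height_eq_of_mem_orbit hp h, hq.height_residueEquiv]

theorem hasOrder_normalForm (hp : p ≠ 2) (hn : n < p) (hs : 0 < s) (hsp : s < p) (a : k) :
    HasOrder n (normalForm k p n s a) := by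
  obtain ⟨r, hr, -, hq⟩ := normalForm_eq_smul_sq (p := p) hp hs hsp n a
  exact hq ▸ hasOrder_smul_sq hn one_ne_zero hr

theorem dim_orbit_normalForm_eq_topologicalKrullDim (hp : 3 < p) (hn : n + i + 1 = p)
    (hs : 2 * s + 1 = i ∨ 2 * s + 1 = i + p) (hs0 : 0 < s) (a : k) :
    dim (orbit (residueEquiv (normalForm k p n s a))) =
      topologicalKrullDim {v : Fin (i + 1) → k | v 0 ≠ 0 ∧ ∃ b ≠ 0, v 0 * b ^ i = b ∧
        ∀ t : Fin (i + 1), (t : ℕ) = s → v t = v 0 * (b ^ s * (2⁻¹ * a))} := by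
  rw [dim_eq_topologicalKrullDim_ofSqrtCoords (n := n) (by lia) hn fun q hq =>
    hasOrder_of_mem_orbit hp (hasOrder_normalForm (by lia) (by lia) hs0 (by lia) a) hq]
  refine congrArg (fun S : Set _ => topologicalKrullDim S)
    (Set.ext fun v => and_congr_right fun hv => ?_)
  rw [ofSqrtCoords, smul_sq_mem_orbit_normalForm_iff hp hn hs hs0 hv
    (truncCoeff_zero_unitOfCoords (by lia) hv)]
  refine exists_congr fun b => and_congr_right fun _ => and_congr_right fun _ => ?_
  constructor
  · rintro h t rfl
    rw [← h (by lia), truncCoeff_unitOfCoords (by lia), mul_inv_cancel_left₀ hv]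
  · intro h hsi
    have := truncCoeff_unitOfCoords (p := p) (by lia) v ⟨s, by lia⟩
    rw [h ⟨s, by lia⟩ rfl, inv_mul_cancel_left₀ hv] at this
    exact this

theorem dim_orbit_normalForm_eq_topologicalKrullDim_of_fin (hp : 3 < p) (hn : n + i + 1 = p)
    (hs : 2 * s + 1 = i ∨ 2 * s + 1 = i + p) (hs0 : 0 < s) {t : Fin (i + 1)} (ht : (t : ℕ) = s)
    (a : k) :
    dim (orbit (residueEquiv (normalForm k p n s a))) =
      topologicalKrullDim {v : Fin (i + 1) → k | v 0 ≠ 0 ∧ ∃ b ≠ 0, v 0 * b ^ i = b ∧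
        v t = v 0 * (b ^ s * (2⁻¹ * a))} := by
  subst ht
  rw [dim_orbit_normalForm_eq_topologicalKrullDim hp hn hs hs0]
  exact congrArg (fun S : Set _ => topologicalKrullDim S)
    (Set.ext fun v => by simp only [Fin.val_inj, forall_eq])

theorem exists_mul_pow_odd_iff [IsSepClosed k] [NeZero (s : k)] {α β c : k} (hc : c ≠ 0) :
    (α ≠ 0 ∧ ∃ b ≠ 0, α * b ^ (2 * s + 1) = b ∧ β = α * (b ^ s * c)) ↔
      β ≠ 0 ∧ α = (β * c⁻¹) ^ 2 := by
  constructor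
  · rintro ⟨hα, b, hb, hbi, rfl⟩
    have hb2 : α * (b ^ s) ^ 2 = 1 := mul_right_cancel₀ hb (by linear_combination hbi)
    refine ⟨mul_ne_zero hα (mul_ne_zero (pow_ne_zero _ hb) hc), ?_⟩
    rw [mul_assoc, mul_assoc, mul_inv_cancel₀ hc]
    linear_combination -α * hb2
  · rintro ⟨hβ, rfl⟩
    obtain ⟨b, hb⟩ := IsSepClosed.exists_pow_nat_eq (c / β) s
    have hb0 : b ≠ 0 := by
      rintro rfl
      rw [zero_pow (NeZero.of_neZero_natCast k).ne] at hb
      exact div_ne_zero hc hβ hb.symm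
    refine ⟨pow_ne_zero 2 (mul_ne_zero hβ (inv_ne_zero hc)), b, hb0, ?_, ?_⟩
    · rw [pow_succ b, mul_comm 2, pow_mul b, hb]
      field_simp
    · rw [hb]
      field_simp

theorem exists_mul_pow_succ_iff {m : ℕ} {α β c : k} (hc : c ≠ 0) :
    (α ≠ 0 ∧ ∃ b ≠ 0, α * b ^ (m + 1) = b ∧ β = α * (b ^ (m + 1) * c)) ↔
      β ≠ 0 ∧ α = ((β * c⁻¹) ^ m)⁻¹ := by
  constructor
  · rintro ⟨-, b, hb, hbi, rfl⟩
    rw [← mul_assoc, hbi, mul_inv_cancel_right₀ hc]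
    exact ⟨mul_ne_zero hb hc,
      eq_inv_of_mul_eq_one_left (mul_right_cancel₀ hb (by linear_combination hbi))⟩
  · rintro ⟨hβ, rfl⟩
    have hb : β * c⁻¹ ≠ 0 := mul_ne_zero hβ (inv_ne_zero hc)
    have hbi : ((β * c⁻¹) ^ m)⁻¹ * (β * c⁻¹) ^ (m + 1) = β * c⁻¹ := by
      rw [pow_succ, inv_mul_cancel_left₀ (pow_ne_zero m hb)]
    refine ⟨inv_ne_zero (pow_ne_zero m hb), _, hb, hbi, ?_⟩
    rw [← mul_assoc, hbi, inv_mul_cancel_right₀ hc]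

theorem dim_orbit_normalForm_top [Infinite k] {m : ℕ} (hp : 3 < p) (hm : m + 2 = p) {a : k}
    (ha : a ≠ 0) : dim (orbit (residueEquiv (normalForm k p 0 (m + 1) a))) = (m + 1 : ℕ) := by
  have hc : 2⁻¹ * a ≠ 0 := mul_ne_zero (inv_ne_zero (two_ne_zero_of_char_ne (p := p) (by lia))) ha
  rw [dim_orbit_normalForm_eq_topologicalKrullDim_of_fin hp (i := m + 1) (by lia) (.inr (by lia))
      m.succ_pos (Fin.val_last _),
    ← topologicalKrullDim_ne_zero_and_eq (Fin.last_pos' (n := m + 1)).ne'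
      ((((IsRegularOn.coord _).mul (.const (2⁻¹ * a)⁻¹)).pow m).inv fun v hv =>
        pow_ne_zero m (mul_ne_zero (hv _ rfl) (inv_ne_zero hc)))]
  exact congrArg (fun S : Set _ => topologicalKrullDim S)
    (Set.ext fun v => exists_mul_pow_succ_iff hc)

theorem dim_orbit_smul_x_pow [Infinite k] (hp : 3 < p) {α : k} (hα : α ≠ 0) :
    dim (orbit (residueEquiv (α • x k p ^ (p - 2)))) = 1 := by
  have hO : ∀ q : TruncPoly k p, residueEquiv q ∈ orbit (residueEquiv (α • x k p ^ (p - 2))) →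
      HasOrder (p - 2) q := fun q hq => by
    obtain ⟨hdvd, hlead⟩ := (mem_orbit_smul_x_pow_iff hp hα).mp hq
    exact ⟨hdvd, hlead.trans_ne hα⟩
  have hlead {v : Fin (1 + 1) → k} (hv : v 0 ≠ 0) :
      truncCoeff (p - 2) (ofSqrtCoords p (p - 2) v) = v 0 :=
    truncCoeff_smul_sq (by lia) _ (truncCoeff_zero_unitOfCoords (by lia) hv)
  have hgraph := topologicalKrullDim_graph (t := (0 : Fin 2)) (S := nonzeroSet k ∅) (.const α)
  rw [topologicalKrullDim_nonzeroSet, natCard_fin_ne] at hgraph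
  rw [dim_eq_topologicalKrullDim_ofSqrtCoords (i := 1) (by lia) (by lia) hO]
  refine Eq.trans (congrArg (fun S : Set _ => topologicalKrullDim S) (Set.ext fun v => ?_)) hgraph
  simp only [mem_orbit_smul_x_pow_iff hp hα, Set.mem_ofPred_eq]
  constructor
  · rintro ⟨hv, -, h⟩
    exact ⟨fun _ hj => hj.elim, (hlead hv).symm.trans h⟩
  · rintro ⟨-, h⟩
    have hv : v 0 ≠ 0 := h.trans_ne hα
    exact ⟨hv, dvd_smul_of_dvd _ (dvd_mul_right _ _), (hlead hv).trans h⟩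

variable [IsSepClosed k]

theorem dim_orbit_normalForm_of_lt (hp : 3 < p) (hn : n + i + 1 = p) (hs : 2 * s + 1 = i + p)
    (his : i < s) (a : k) : dim (orbit (residueEquiv (normalForm k p n s a))) = (i + 1 : ℕ) := by
  have := infinite_of_isSepClosed k
  have := (Fact.out : p.Prime).eq_two_or_odd
  have hset : {v : Fin (i + 1) → k | v 0 ≠ 0 ∧ ∃ b ≠ 0, v 0 * b ^ i = b ∧
      ∀ t : Fin (i + 1), (t : ℕ) = s → v t = v 0 * (b ^ s * (2⁻¹ * a))} = nonzeroSet k {0} := by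
    ext v
    simp only [nonzeroSet, Set.mem_ofPred_eq, Set.mem_singleton_iff, forall_eq]
    refine and_iff_left_of_imp fun hv => ?_
    obtain ⟨b, hb, hbi⟩ := exists_mul_pow_eq_self (p := p) (i := i) (by lia) (by lia) hv
    exact ⟨b, hb, hbi, fun t ht => by lia⟩
  rw [dim_orbit_normalForm_eq_topologicalKrullDim hp hn (.inr hs) (by lia), hset,
    topologicalKrullDim_nonzeroSet, Nat.card_fin]

theorem dim_orbit_normalForm_zero (hp : 3 < p) (hn : n + i + 1 = p)
    (hs : 2 * s + 1 = i ∨ 2 * s + 1 = i + p) (hs0 : 0 < s) (hsi : s ≤ i) :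
    dim (orbit (residueEquiv (normalForm k p n s 0))) = i := by
  have := infinite_of_isSepClosed k
  obtain ⟨t, ht⟩ : ∃ t : Fin (i + 1), (t : ℕ) = s := ⟨⟨s, by lia⟩, rfl⟩
  have ht0 : 0 ≠ t := Fin.ne_of_val_ne (hs0.ne.trans_eq ht.symm)
  rw [dim_orbit_normalForm_eq_topologicalKrullDim_of_fin hp hn hs hs0 ht,
    ← topologicalKrullDim_ne_zero_and_eq ht0 (.const (0 : k))]
  refine congrArg (fun S : Set _ => topologicalKrullDim S)
    (Set.ext fun v => and_congr_right fun hv => ?_)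
  obtain ⟨b, hb, hbi⟩ := exists_mul_pow_eq_self (p := p) (i := i) (by lia) (by lia) hv
  simp only [mul_zero]
  exact ⟨fun ⟨_, _, _, h⟩ => h, fun h => ⟨b, hb, hbi, h⟩⟩

theorem dim_orbit_normalForm_of_odd (hp : 3 < p) (hn : n + (2 * s + 1) + 1 = p) (hs0 : 0 < s)
    {a : k} (ha : a ≠ 0) :
    dim (orbit (residueEquiv (normalForm k p n s a))) = (2 * s + 1 : ℕ) := by
  have := infinite_of_isSepClosed k
  have : NeZero (s : k) := ⟨natCast_ne_zero_of_lt (p := p) (by lia) (by lia)⟩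
  have hc : 2⁻¹ * a ≠ 0 := mul_ne_zero (inv_ne_zero (two_ne_zero_of_char_ne (p := p) (by lia))) ha
  obtain ⟨t, ht⟩ : ∃ t : Fin (2 * s + 1 + 1), (t : ℕ) = s := ⟨⟨s, by lia⟩, rfl⟩
  have ht0 : t ≠ 0 := Fin.ne_of_val_ne (ht.trans_ne hs0.ne')
  rw [dim_orbit_normalForm_eq_topologicalKrullDim_of_fin hp hn (.inl rfl) hs0 ht,
    ← topologicalKrullDim_ne_zero_and_eq ht0
      (((IsRegularOn.coord ⟨t, ht0⟩).mul (.const (2⁻¹ * a)⁻¹)).pow 2)]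
  exact congrArg (fun S : Set _ => topologicalKrullDim S)
    (Set.ext fun v => exists_mul_pow_odd_iff hc)

end OrbitDimension

section Representatives

variable {k : Type*} [Field k] {p : ℕ} [Fact p.Prime] [CharP k p] {n i s : ℕ}

theorem normalForm_mem_orbit_normalForm_iff (hp : 3 < p) (hn : n + i + 1 = p)
    (hs : 2 * s + 1 = i ∨ 2 * s + 1 = i + p) (hs0 : 0 < s) {a a' : k} :
    residueEquiv (normalForm k p n s a') ∈ orbit (residueEquiv (normalForm k p n s a)) ↔
      ∃ b ≠ 0, b ^ i = b ∧ (s ≤ i → a' = b ^ s * a) := by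
  obtain ⟨r, hr, hrs, hr'⟩ := normalForm_eq_smul_sq (p := p) (by lia) hs0 (by lia) n a'
  have h2 : (2 : k) ≠ 0 := two_ne_zero_of_char_ne (p := p) (by lia)
  rw [hr', smul_sq_mem_orbit_normalForm_iff hp hn hs hs0 one_ne_zero hr, hrs]
  simp only [one_mul, mul_left_comm _ (2⁻¹ : k), mul_right_inj' (inv_ne_zero h2)]

theorem exists_pow_succ_eq_iff_pow_eq_pow {m : ℕ} (hm : m ≠ 0) {a a' : k} :
    (∃ b ≠ 0, b ^ (m + 1) = b ∧ a' = b ^ (m + 1) * a) ↔ a ^ m = a' ^ m := by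
  constructor
  · rintro ⟨b, hb, hbm, rfl⟩
    have hb1 : b ^ m = 1 := mul_right_cancel₀ hb (by linear_combination hbm)
    rw [hbm, mul_pow, hb1, one_mul]
  · intro h
    rcases eq_or_ne a 0 with rfl | ha
    · rw [zero_pow hm] at h
      exact ⟨1, one_ne_zero, one_pow _, by rw [eq_zero_of_pow_eq_zero h.symm, mul_zero]⟩
    · have ha' : a' ≠ 0 := fun h0 => pow_ne_zero m ha (by rw [h, h0, zero_pow hm])
      have hdiv : (a' / a) ^ (m + 1) = a' / a := by
        rw [pow_succ, div_pow, h, div_self (pow_ne_zero m ha'), one_mul]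
      exact ⟨a' / a, div_ne_zero ha' ha, hdiv, by rw [hdiv, div_mul_cancel₀ _ ha]⟩

variable [IsSepClosed k]

theorem isOrbitRepresentatives_normalForm (hp : 3 < p) (hn : n + i + 1 = p)
    (hs : 2 * s + 1 = i ∨ 2 * s + 1 = i + p) (hs0 : 0 < s) {S : Set k}
    (hS : ∀ a, ∃! a', a' ∈ S ∧ ∃ b ≠ 0, b ^ i = b ∧ (s ≤ i → a' = b ^ s * a)) :
    IsOrbitRepresentatives (i : ℤ) {χ | ∃ a ∈ S, χ = residueEquiv (normalForm k p n s a)} := by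
  have := (Fact.out : p.Prime).eq_two_or_odd
  have hheight (q : TruncPoly k p) : height (residueEquiv q) = i ↔ HasOrder n q :=
    height_residueEquiv_eq_iff (by lia) (by lia)
  constructor
  · rintro _ ⟨a, -, rfl⟩
    exact (hheight _).mpr (hasOrder_normalForm (by lia) (by lia) hs0 (by lia) a)
  · intro χ hχ
    obtain ⟨q, rfl⟩ := residueEquiv.surjective χ
    have hq := (hheight q).mp hχ
    obtain ⟨b, hb, hbi⟩ := exists_mul_pow_eq_self (p := p) (i := i) (by lia) (by lia) hq.2
    obtain ⟨a, ha⟩ := hq.exists_normalForm_mem_orbit hp hn hs hb hbi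
    obtain ⟨a', ⟨ha'S, ha'⟩, huniq⟩ := hS a
    refine ⟨_, ⟨⟨a', ha'S, rfl⟩, mem_orbit_trans ha
      ((normalForm_mem_orbit_normalForm_iff hp hn hs hs0).mpr ha')⟩, ?_⟩
    rintro _ ⟨⟨a'', ha''S, rfl⟩, ha''⟩
    rw [huniq a'' ⟨ha''S, (normalForm_mem_orbit_normalForm_iff hp hn hs hs0).mp
      (mem_orbit_trans (mem_orbit_symm ha) ha'')⟩]

theorem exists_pow_odd_eq_iff_sq_eq_sq [NeZero (s : k)] {a a' : k} :
    (∃ b ≠ 0, b ^ (2 * s + 1) = b ∧ a' = b ^ s * a) ↔ a ^ 2 = a' ^ 2 := by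
  constructor
  · rintro ⟨b, hb, hbs, rfl⟩
    have hb2 : (b ^ s) ^ 2 = 1 := mul_right_cancel₀ hb (by linear_combination hbs)
    rw [mul_pow, hb2, one_mul]
  · intro h
    obtain rfl | rfl := sq_eq_sq_iff_eq_or_eq_neg.mp h.symm
    · exact ⟨1, one_ne_zero, one_pow _, by rw [one_pow, one_mul]⟩
    · obtain ⟨b, hb⟩ := IsSepClosed.exists_pow_nat_eq (-1 : k) s
      refine ⟨b, ?_, by linear_combination b * (b ^ s - 1) * hb, by rw [hb, neg_one_mul]⟩
      rintro rfl
      rw [zero_pow (NeZero.of_neZero_natCast k).ne] at hb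
      exact neg_ne_zero.mpr one_ne_zero hb.symm

end Representatives

section DualBasis

variable {k : Type*} [Field k] {p : ℕ} [CharP k p]

theorem e'_add_smul_e'_eq_residueEquiv {j l : ℤ} {n s : ℕ} (hj : j + n + 2 = p)
    (hl : l + (n + s) + 2 = p) (hl' : -1 ≤ l) (a : k) :
    e' k p j + a • e' k p l = residueEquiv (normalForm k p n s a) := by
  rw [e'_eq_residueEquiv hj (by lia), e'_eq_residueEquiv (n := n + s) (by lia) hl', normalForm,
    map_add, map_smul]

theorem smul_e'_zero_eq_residueEquiv (hp : 1 < p) (a : k) :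
    a • e' k p 0 = residueEquiv (a • x k p ^ (p - 2)) := by
  rw [e'_eq_residueEquiv (n := p - 2) (by lia) (by lia), map_smul]

variable [Fact p.Prime]

theorem dim_orbit_smul_e'_zero [Infinite k] (hp : 3 < p) {a : k} (ha : a ≠ 0) :
    dim (orbit (a • e' k p 0)) = 1 := by
  rw [smul_e'_zero_eq_residueEquiv (by lia), dim_orbit_smul_x_pow hp ha]

theorem isOrbitRepresentatives_one (hp : 3 < p) :
    IsOrbitRepresentatives 1 {χ | ∃ a : k, a ≠ 0 ∧ χ = a • e' k p 0} := by
  have hheight (q : TruncPoly k p) : height (residueEquiv q) = 1 ↔ HasOrder (p - 2) q :=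
    height_residueEquiv_eq_iff (by lia) (by lia)
  simp only [smul_e'_zero_eq_residueEquiv (k := k) (p := p) (by lia)]
  constructor
  · rintro _ ⟨a, ha, rfl⟩
    obtain ⟨hdvd, hlead⟩ := (mem_orbit_smul_x_pow_iff hp ha).mp (mem_orbit_self _)
    exact (hheight _).mpr ⟨hdvd, hlead.trans_ne ha⟩
  · intro χ hχ
    obtain ⟨q, rfl⟩ := residueEquiv.surjective χ
    have hq := (hheight q).mp hχ
    refine ⟨_, ⟨⟨truncCoeff (p - 2) q, hq.2, rfl⟩,
      mem_orbit_symm ((mem_orbit_smul_x_pow_iff hp hq.2).mpr ⟨hq.1, rfl⟩)⟩, ?_⟩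
    rintro _ ⟨⟨a, ha, rfl⟩, h⟩
    rw [((mem_orbit_smul_x_pow_iff hp ha).mp (mem_orbit_symm h)).2]

variable [IsSepClosed k]

theorem isOrbitRepresentatives_of_even (hp : 3 < p) {i : ℕ} (hip : i ≤ p - 3) (hi : Even i) :
    IsOrbitRepresentatives (i : ℤ) {e' k p ((i : ℤ) - 1)} := by
  obtain ⟨m, rfl⟩ := hi
  have := (Fact.out : p.Prime).eq_two_or_odd
  have hreps := isOrbitRepresentatives_normalForm (k := k) (S := {0}) hp
    (n := p - 1 - (m + m)) (i := m + m) (s := m + (p - 1) / 2) (by lia) (.inr (by lia)) (by lia)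
    fun a => ⟨0, ⟨rfl, 1, one_ne_zero, one_pow _, by lia⟩, fun _ h => h.1⟩
  simp only [Set.mem_singleton_iff, exists_eq_left, normalForm_zero] at hreps
  rwa [e'_eq_residueEquiv (n := p - 1 - (m + m)) (by lia) (by lia)]

theorem isOrbitRepresentatives_of_odd (hp : 3 < p) {S : Set k} (hS : IsPowRepresentatives k 2 S)
    {i : ℕ} (h3 : 3 ≤ i) (hip : i ≤ p - 2) (hi : Odd i) :
    IsOrbitRepresentatives (i : ℤ)
      {χ | ∃ a ∈ S, χ = e' k p ((i : ℤ) - 1) + a • e' k p (((i : ℤ) - 1) / 2)} := by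
  obtain ⟨s, rfl⟩ := hi
  have : NeZero (s : k) := ⟨natCast_ne_zero_of_lt (p := p) (by lia) (by lia)⟩
  have hsi : s ≤ 2 * s + 1 := by lia
  simp only [e'_add_smul_e'_eq_residueEquiv (k := k) (p := p) (j := ((2 * s + 1 : ℕ) : ℤ) - 1)
    (l := (((2 * s + 1 : ℕ) : ℤ) - 1) / 2) (n := p - 2 - 2 * s) (s := s) (by lia) (by lia) (by lia)]
  refine isOrbitRepresentatives_normalForm hp (by lia) (.inl rfl) (by lia) fun a => ?_
  simpa only [hsi, forall_const, exists_pow_odd_eq_iff_sq_eq_sq] using hS a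

theorem isOrbitRepresentatives_top (hp : 3 < p) {S : Set k}
    (hS : IsPowRepresentatives k (p - 2) S) :
    IsOrbitRepresentatives ((p : ℤ) - 1)
      {χ | ∃ a ∈ S, χ = e' k p ((p : ℤ) - 2) + a • e' k p (-1)} := by
  obtain ⟨m, hm⟩ : ∃ m, p = m + 2 := ⟨p - 2, by lia⟩
  rw [show p - 2 = m by lia] at hS
  simp only [e'_add_smul_e'_eq_residueEquiv (k := k) (p := p) (j := (p : ℤ) - 2)
    (l := -1) (n := 0) (s := m + 1) (by lia) (by lia) (by lia)]
  rw [show (p : ℤ) - 1 = (m + 1 : ℕ) by lia]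
  refine isOrbitRepresentatives_normalForm hp (by lia) (.inr (by lia)) (by lia) fun a => ?_
  simpa only [le_refl, forall_const, exists_pow_succ_eq_iff_pow_eq_pow (show m ≠ 0 by lia)] using
    hS a

theorem dim_orbit_e'_of_even (hp : 3 < p) {i : ℕ} (hip : i ≤ p - 3) (hi : Even i) :
    dim (orbit (e' k p ((i : ℤ) - 1))) = (i + 1 : ℕ) := by
  obtain ⟨m, rfl⟩ := hi
  have := (Fact.out : p.Prime).eq_two_or_odd
  rw [e'_eq_residueEquiv (n := p - 1 - (m + m)) (by lia) (by lia),
    ← normalForm_zero _ (m + (p - 1) / 2)]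
  exact dim_orbit_normalForm_of_lt hp (by lia) (by lia) (by lia) 0

theorem dim_orbit_e'_add_smul_e'_of_odd (hp : 3 < p) {i : ℕ} (h3 : 3 ≤ i) (hip : i ≤ p - 2)
    (hi : Odd i) (a : k) :
    dim (orbit (e' k p ((i : ℤ) - 1) + a • e' k p (((i : ℤ) - 1) / 2))) = i := by
  obtain ⟨s, rfl⟩ := hi
  rw [e'_add_smul_e'_eq_residueEquiv (n := p - 2 - 2 * s) (s := s) (by lia) (by lia) (by lia)]
  rcases eq_or_ne a 0 with rfl | ha
  · exact dim_orbit_normalForm_zero hp (by lia) (.inl rfl) (by lia) (by lia)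
  · exact dim_orbit_normalForm_of_odd hp (by lia) (by lia) ha

theorem dim_orbit_e'_add_smul_e'_top (hp : 3 < p) (a : k) :
    dim (orbit (e' k p ((p : ℤ) - 2) + a • e' k p (-1))) = (p - 1 : ℕ) := by
  have := infinite_of_isSepClosed k
  obtain ⟨m, hm⟩ : ∃ m, m + 2 = p := ⟨p - 2, by lia⟩
  rw [e'_add_smul_e'_eq_residueEquiv (n := 0) (s := m + 1) (by lia) (by lia) (by lia),
    show p - 1 = m + 1 by lia]
  rcases eq_or_ne a 0 with rfl | ha
  · exact dim_orbit_normalForm_zero hp (by lia) (.inr (by lia)) m.succ_pos le_rfl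
  · exact dim_orbit_normalForm_top hp hm ha

end DualBasis

end WittAlgebra

end

open WittAlgebra in
theorem theorem3_general {k : Type*} [Field k] [IsSepClosed k] (p : ℕ) [Fact p.Prime] [CharP k p]
    (hp : 3 < p) (K : ℕ → Set k) (hK : ∀ j, IsPowRepresentatives k j (K j)) :
    (∀ χ : Module.Dual k (W k p), ∀ ψ ∈ orbit χ, height ψ = height χ) ∧
    IsOrbitRepresentatives 1
      {χ | ∃ a : k, a ≠ 0 ∧ χ = a • e' k p 0} ∧
    (∀ i : ℕ, i ≤ p - 3 → Even i →
      IsOrbitRepresentatives (i : ℤ) {e' k p ((i : ℤ) - 1)}) ∧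
    (∀ i : ℕ, 3 ≤ i → i ≤ p - 2 → Odd i →
      IsOrbitRepresentatives (i : ℤ)
        {χ | ∃ a ∈ K 2, χ = e' k p ((i : ℤ) - 1) + a • e' k p (((i : ℤ) - 1) / 2)}) ∧
    IsOrbitRepresentatives ((p : ℤ) - 1)
      {χ | ∃ a ∈ K (p - 2), χ = e' k p ((p : ℤ) - 2) + a • e' k p (-1)} ∧
    (∀ a : k, a ≠ 0 → dim (orbit (a • e' k p 0)) = 1) ∧
    (∀ i : ℕ, i ≤ p - 3 → Even i →
      dim (orbit (e' k p ((i : ℤ) - 1))) = ((i + 1 : ℕ) : WithBot ℕ∞)) ∧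
    (∀ i : ℕ, 3 ≤ i → i ≤ p - 2 → Odd i → ∀ a : k,
      dim (orbit (e' k p ((i : ℤ) - 1) + a • e' k p (((i : ℤ) - 1) / 2))) = (i : WithBot ℕ∞)) ∧
    (∀ a : k, dim (orbit (e' k p ((p : ℤ) - 2) + a • e' k p (-1))) = ((p - 1 : ℕ) : WithBot ℕ∞)) :=
  have := infinite_of_isSepClosed k
  ⟨fun _ _ => height_eq_of_mem_orbit hp, isOrbitRepresentatives_one hp,
    fun _ => isOrbitRepresentatives_of_even hp,
    fun _ => isOrbitRepresentatives_of_odd hp (hK 2), isOrbitRepresentatives_top hp (hK (p - 2)),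
    fun _ => dim_orbit_smul_e'_zero hp, fun _ => dim_orbit_e'_of_even hp,
    fun _ => dim_orbit_e'_add_smul_e'_of_odd hp, dim_orbit_e'_add_smul_e'_top hp⟩

theorem theorem3 {k : Type*} [Field k] [IsAlgClosed k] (p : ℕ) [Fact p.Prime] [CharP k p]
    (hp : 3 < p)
    (K : ℕ → Set k) (hK : ∀ j, WittAlgebra.IsPowRepresentatives k j (K j)) :
    -- the height is constant on orbits
    (∀ χ : Module.Dual k (WittAlgebra.W k p), ∀ ψ ∈ WittAlgebra.orbit χ,
      WittAlgebra.height ψ = WittAlgebra.height χ) ∧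
    -- representatives of the orbits of each height
    WittAlgebra.IsOrbitRepresentatives 1
      {χ | ∃ a : k, a ≠ 0 ∧ χ = a • WittAlgebra.e' k p 0} ∧
    (∀ i : ℕ, i ≤ p - 3 → Even i →
      WittAlgebra.IsOrbitRepresentatives (i : ℤ) {WittAlgebra.e' k p ((i : ℤ) - 1)}) ∧
    (∀ i : ℕ, 3 ≤ i → i ≤ p - 2 → Odd i →
      WittAlgebra.IsOrbitRepresentatives (i : ℤ)
        {χ | ∃ a ∈ K 2, χ = WittAlgebra.e' k p ((i : ℤ) - 1)
          + a • WittAlgebra.e' k p (((i : ℤ) - 1) / 2)}) ∧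
    WittAlgebra.IsOrbitRepresentatives ((p : ℤ) - 1)
      {χ | ∃ a ∈ K (p - 2), χ = WittAlgebra.e' k p ((p : ℤ) - 2)
        + a • WittAlgebra.e' k p (-1)} ∧
    -- dimensions of the orbits
    (∀ a : k, a ≠ 0 →
      WittAlgebra.dim (WittAlgebra.orbit (a • WittAlgebra.e' k p 0)) = 1) ∧
    (∀ i : ℕ, i ≤ p - 3 → Even i →
      WittAlgebra.dim (WittAlgebra.orbit (WittAlgebra.e' k p ((i : ℤ) - 1)))
        = ((i + 1 : ℕ) : WithBot ℕ∞)) ∧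
    (∀ i : ℕ, 3 ≤ i → i ≤ p - 2 → Odd i → ∀ a : k,
      WittAlgebra.dim (WittAlgebra.orbit (WittAlgebra.e' k p ((i : ℤ) - 1)
          + a • WittAlgebra.e' k p (((i : ℤ) - 1) / 2)))
        = (i : WithBot ℕ∞)) ∧
    (∀ a : k,
      WittAlgebra.dim (WittAlgebra.orbit (WittAlgebra.e' k p ((p : ℤ) - 2)
          + a • WittAlgebra.e' k p (-1)))
        = ((p - 1 : ℕ) : WithBot ℕ∞)) :=
  theorem3_general p hp K hK
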